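/- Let $n\ge 1$ and let $\mathbb D\subset\mathbb C$ be the open unit disc. There is a constant $C>0$ depending only on $n$ such that the following holds. Let $D\subset\mathbb C^n$ be a $\mathbb C$-convex domain containing no complex lines, i.e. a domain such that every non-empty intersection of $D$ with a complex line is biholomorphic to $\mathbb D$, and let $z\in D$. For $X\in\mathbb C^n$ let $d_D(z;X):=\sup\{r>0: z+r\mathbb D X\subset D\}\in(0,\infty]$. A *minimal basis* of $D$ at $z$ is an orthonormal basis $e_1,\dots,e_n$ of $\mathbb C^n$ with numbers $s_1,\dots,s_n>0$ such that, for each $k$, with $H_{k-1}:=z+\{e_1,\dots,e_{k-1}\}^\perp$, one has $s_k=\operatorname{dist}(z,\partial_{H_{k-1}}(D\cap H_{k-1}))$ and $z+s_ke_k\in\partial_{H_{k-1}}(D\cap H_{k-1})$ (boundaries relative to $H_{k-1}$). A *maximal basis* of $D$ at $z$ is an orthonormal basis $a_1,\dots,a_n$ with numbers $m_1,\dots,m_n>0$ such that $m_1=\operatorname{dist}(z,\partial D)$; for $k\ge2$, $m_k=d_D(z;a_k)=\max d_D(z;v)$, the maximum being over all unit vectors $v$ orthogonal to $a_1,\dots,a_{k-1}$;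 and $z+m_ka_k\in\partial D$ for all $k\geq 1$. Put $$E_D(z;X):=\sum_{j=1}^n\frac{|\langle X,e_j\rangle|}{s_j},\qquad A_D(z;X):=\sum_{j=1}^n\frac{|\langle X,a_j\rangle|}{m_j}.$$ Write $f\sim g$ for $f\le Cg$ and $g\le Cf$. Then for every maximal basis of $D$ at $z$ and every $X\in\mathbb C^n$: 1. $A_D(z;X)\sim E_D(z;X)$ for every minimal basis of $D$ at $z$; 2. $1/d_D(z;X)\sim A_D(z;X)$ (with $1/\infty=0$); 3. $F_D(z;X)\sim A_D(z;X)$, where $F_D$ is any of the Carathéodory metric $\sup\{|f'(z)X|: f\in\mathcal O(D,\mathbb D)\}$, the Kobayashi metric $\inf\{|\alpha|:\alpha\in\mathbb C,\ \exists\varphi\in\mathcal O(\mathbb D,D),\ \varphi(0)=z,\ \alpha\varphi'(0)=X\}$, and the Bergman metric $K_D(z)^{-1/2}\sup\{|f'(z)X|: f\in L^2_h(D),\ \|f\|\le1,\ f(z)=0\}$; 4. $K_D(z)\sim 1/\prod_{j=1}^n m_j^2$, where $K_D(z)=\sup\{|f(z)|^2: f\in L^2_h(D),\ \|f\|\le 1\}$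 is the Bergman kernel on the diagonal. Here $L^2_h(D)$ is the space of holomorphic functions on $D$ that are square integrable with respect to Lebesgue measure, and $\|\cdot\|$ is its norm. -/

import Mathlib

open Set Metric MeasureTheory
open scoped NNReal ENNReal

namespace ExtremalBasis

/-- The complex Euclidean space `ℂⁿ`, with its Hermitian inner product and Euclidean norm. -/
abbrev Cn (n : ℕ) : Type := EuclideanSpace ℂ (Fin n)

/-- The open unit disc in `ℂ`. -/
def disc : Set ℂ := ball (0 : ℂ) 1

/-- The set `S ⊆ ℂ` is biholomorphic to the unit disc. (Used for open sets `S`, on which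
`DifferentiableOn ℂ` means holomorphic.) -/
def BiholomorphicToDisc (S : Set ℂ) : Prop :=
  ∃ f g : ℂ → ℂ, DifferentiableOn ℂ f S ∧ DifferentiableOn ℂ g disc ∧
    MapsTo f S disc ∧ MapsTo g disc S ∧ LeftInvOn g f S ∧ LeftInvOn f g disc

/-- `D` is a `ℂ`-convex domain containing no complex lines: it is open and connected, and each
non-empty intersection with a complex line `{p + ζ v : ζ ∈ ℂ}`, `v ≠ 0`, read in the affine
coordinate `ζ` of the line, is biholomorphic to the unit disc. -/
structure IsCConvexDomainWithoutLines {n : ℕ} (D : Set (Cn n)) : Prop where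
  isOpen : IsOpen D
  isConnected : IsConnected D
  slice : ∀ p v : Cn n, v ≠ 0 → {ζ : ℂ | p + ζ • v ∈ D}.Nonempty →
    BiholomorphicToDisc {ζ : ℂ | p + ζ • v ∈ D}

/-- The boundary distance `d_D(q; X) = sup {r : q + r𝔻X ⊆ D}` of `q` in the direction `X`.
It takes values in `[0, ∞]`; it is `∞` for `X = 0` and `q ∈ D`. -/
noncomputable def dirDist {n : ℕ} (D : Set (Cn n)) (q X : Cn n) : ℝ≥0∞ :=
  ⨆ (r : ℝ≥0) (_ : ∀ ζ : ℂ, ‖ζ‖ < r → q + ζ • X ∈ D), (r : ℝ≥0∞)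

/-- The affine plane through `q` orthogonal to the vectors `b j`, `j < k`. -/
def orthPlane {n : ℕ} (q : Cn n) (b : Fin n → Cn n) (k : Fin n) : Set (Cn n) :=
  {p | ∀ j < k, inner ℂ (b j) (p - q) = 0}

/-- The boundary of `D ∩ H` relative to `H`. -/
def relFrontier {n : ℕ} (H D : Set (Cn n)) : Set (Cn n) :=
  Subtype.val '' frontier (Subtype.val ⁻¹' D : Set H)

/-- `e` is a minimal basis of `D` at `q` with numbers `s`: for each `k`, the point `q + s_k e_k`
is a boundary point, nearest to `q`, of the intersection of `D` with the plane through `q`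
orthogonal to `e_j`, `j < k`. (For the first index the plane is the whole space.) -/
structure IsMinimalBasis {n : ℕ} (D : Set (Cn n)) (q : Cn n)
    (e : OrthonormalBasis (Fin n) ℂ (Cn n)) (s : Fin n → ℝ≥0) : Prop where
  dist_eq : ∀ k, infEDist q (relFrontier (orthPlane q e k) D) = s k
  mem_frontier : ∀ k, q + (s k : ℝ) • e k ∈ relFrontier (orthPlane q e k) D

/-- `a` is a maximal basis of `D` at `q` with numbers `m`, in the order of its construction:
the first vector points to a boundary point nearest to `q`; each later `a_k` maximises the
directional boundary distance among the unit vectors orthogonal to `a_j`, `j < k`, with maximal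
value `m_k`; and all the points `q + m_k a_k` are boundary points of `D`. -/
structure IsMaximalBasis {n : ℕ} (D : Set (Cn n)) (q : Cn n)
    (a : OrthonormalBasis (Fin n) ℂ (Cn n)) (m : Fin n → ℝ≥0) : Prop where
  first : ∀ k : Fin n, (k : ℕ) = 0 → infEDist q (frontier D) = m k
  dirDist_eq : ∀ k : Fin n, (k : ℕ) ≠ 0 → dirDist D q (a k) = m k
  maximal : ∀ k : Fin n, (k : ℕ) ≠ 0 → ∀ v : Cn n, ‖v‖ = 1 →
    (∀ j < k, inner ℂ (a j) v = 0) → dirDist D q v ≤ m k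
  mem_frontier : ∀ k, q + (m k : ℝ) • a k ∈ frontier D

/-- The sum `∑ j, |⟨X, b_j⟩| / r_j`: this is `E_D(z; X)` for a minimal basis and `A_D(z; X)` for
a maximal basis. All `r_j` are positive for these bases at points of an open set. -/
noncomputable def basisSum {n : ℕ} (b : OrthonormalBasis (Fin n) ℂ (Cn n)) (r : Fin n → ℝ≥0)
    (X : Cn n) : ℝ≥0 :=
  ∑ j, ‖(inner ℂ (b j) X : ℂ)‖₊ / r j

/-- The Carathéodory (–Reiffen) metric `sup {|f'(z)X| : f ∈ 𝒪(D, 𝔻)}`. -/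
noncomputable def caratheodoryMetric {n : ℕ} (D : Set (Cn n)) (z X : Cn n) : ℝ≥0∞ :=
  ⨆ (f : Cn n → ℂ) (_ : DifferentiableOn ℂ f D ∧ MapsTo f D disc), ‖fderiv ℂ f z X‖ₑ

/-- The Kobayashi (–Royden) metric `inf {|α| : ∃ φ ∈ 𝒪(𝔻, D), φ(0) = z, α φ'(0) = X}`. -/
noncomputable def kobayashiMetric {n : ℕ} (D : Set (Cn n)) (z X : Cn n) : ℝ≥0∞ :=
  ⨅ (α : ℂ) (φ : ℂ → Cn n) (_ : DifferentiableOn ℂ φ disc ∧ MapsTo φ disc D ∧ φ 0 = z ∧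
    α • deriv φ 0 = X), ‖α‖ₑ

/-- `f` lies in the closed unit ball of the space of square integrable holomorphic functions
on `D` (with respect to Lebesgue measure). -/
def InBergmanUnitBall {n : ℕ} (D : Set (Cn n)) (f : Cn n → ℂ) : Prop :=
  DifferentiableOn ℂ f D ∧ ∫⁻ w in D, ‖f w‖ₑ ^ 2 ∂volume ≤ 1

/-- The Bergman kernel on the diagonal, `K_D(z) = sup {|f(z)|² : f ∈ L²_h(D), ‖f‖ ≤ 1}`. -/
noncomputable def bergmanKernel {n : ℕ} (D : Set (Cn n)) (z : Cn n) : ℝ≥0∞ :=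
  ⨆ (f : Cn n → ℂ) (_ : InBergmanUnitBall D f), ‖f z‖ₑ ^ 2

/-- The Bergman metric,
`sup {|f'(z)X| : f ∈ L²_h(D), ‖f‖ ≤ 1, f(z) = 0} / K_D(z)^{1/2}`. -/
noncomputable def bergmanMetric {n : ℕ} (D : Set (Cn n)) (z X : Cn n) : ℝ≥0∞ :=
  (⨆ (f : Cn n → ℂ) (_ : InBergmanUnitBall D f ∧ f z = 0), ‖fderiv ℂ f z X‖ₑ) /
    bergmanKernel D z ^ (1 / 2 : ℝ)

/-- `x ≤ C y` and `y ≤ C x`. -/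
def Comparable (C : ℝ≥0) (x y : ℝ≥0∞) : Prop :=
  x ≤ C * y ∧ y ≤ C * x

end ExtremalBasis

namespace ExtremalBasis

open Filter Topology

/-! ### Logarithms on complex line slices -/

section Slices

/-! Everything is compared with one quantity, the support function sup |f(X)| over the functionals f
whose hyperplane {f(w - z) = 1} misses D (`OmitsOne`).

Linear convexity. Every point outside D lies on a complex hyperplane missing D
(`IsCConvexDomainWithoutLines.exists_functional`), so 1/d_D(z;X) equals the support function. To
find the hyperplane, move the point to the origin and take a maximal linear subspace missing D. If
its codimension were at least two, D would meet every direction of a quotient plane with coordinates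
z₁, z₂. Connectedness and simple connectivity of the slices then give a branch of log z₁ over any
rectangle of slopes z₂/z₁ (`hasLogOver_rect`), although z₁ winds around 0 along a loop close to the
infinite slope (`not_forall_slope_hit`).

Bases. The discs of radius r_k in the directions b_k lie in D, so |f(b_k)| ≤ 1/r_k and the support
function is at most the basis sum. Conversely, a nearest boundary point, or maximality of r_k,
controls the k-th coordinate on the orthogonal complement of the earlier vectors. Removing the
coordinates one at a time costs a factor 2 each, so the basis sum is at most 2^n times the support
function. These two facts, recorded in `IsAdapted`, are all that is used of either basis, and they
give items 1 and 2.

Metrics. Affine discs give Kobayashi ≤ 1/d_D, and Cauchy's estimate gives Carathéodory ≤ Kobayashi.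
To close the chain, scale f to cf so that its image contains the unit disc and still omits 1. Then h
= √(1 - cf) stays away from -1 (`exists_root`), and (1 - h)/(1 + h) is bounded on D with derivative
cf/4 at z.

Bergman quantities. Upper bounds follow from the mean value inequality in coordinates scaled by r_j.
For lower bounds, 2/(1 + h) decays like |f|^(-1/2). A product of powers of such functions over a
finite net of directions is 1 at z and has L² norm at most a constant times ∏ r_j
(`exists_peak_function`). -/

theorem isDiscrete_exp_eq_one : IsDiscrete {w : ℂ | Complex.exp w = 1} := by
  refine IsDiscrete.of_nhdsWithin fun x hx => ?_
  rw [le_pure_iff, mem_nhdsWithin]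
  refine ⟨ball x 1, isOpen_ball, mem_ball_self one_pos, ?_⟩
  rintro w ⟨hw, hw1⟩
  have h1 : Complex.exp (w - x) = 1 := by
    rw [Complex.exp_sub, show Complex.exp w = 1 from hw1, show Complex.exp x = 1 from hx, div_one]
  obtain ⟨k, hk⟩ := Complex.exp_eq_one_iff.1 h1
  rw [mem_ball, dist_eq_norm, hk] at hw
  have hk0 : k = 0 := by
    by_contra h0
    have h2 : (1 : ℝ) ≤ |(k : ℝ)| := by exact_mod_cast Int.one_le_abs h0
    have h3 : ‖(k : ℂ) * (2 * Real.pi * Complex.I)‖ = |(k : ℝ)| * (2 * Real.pi) := by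
      simp [abs_of_pos Real.pi_pos]
    rw [h3] at hw
    nlinarith [Real.pi_gt_three]
  rw [hk0] at hk
  have : w - x = 0 := by simpa using hk
  exact sub_eq_zero.1 this

/-- A continuous function with values in the kernel of `exp` is constant on preconnected sets. -/
theorem eq_of_exp_eq_one {X : Type*} [TopologicalSpace X] {A : Set X} (hA : IsPreconnected A)
    {k : X → ℂ} (hk : ContinuousOn k A) (h1 : ∀ x ∈ A, Complex.exp (k x) = 1) {x y : X}
    (hx : x ∈ A) (hy : y ∈ A) : k x = k y :=
  hA.constant_of_mapsTo isDiscrete_exp_eq_one hk h1 hx hy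

/-- A continuous function with values in the kernel of `exp` is constant on a set which fibres,
with preconnected fibres and local sections, over a preconnected set. -/
theorem eq_of_exp_eq_one_of_fibers {X Y : Type*} [TopologicalSpace X] [TopologicalSpace Y]
    {A : Set X} {K : Set Y} {f : X → Y} (hK : IsPreconnected K) (hfA : MapsTo f A K)
    (hfib : ∀ y ∈ K, IsPreconnected (A ∩ f ⁻¹' {y}))
    (hsec : ∀ y ∈ K, ∃ σ : Y → X, ContinuousAt σ y ∧
      ∀ᶠ y' in 𝓝[K] y, σ y' ∈ A ∧ f (σ y') = y')
    {k : X → ℂ} (hk : ContinuousOn k A) (h1 : ∀ x ∈ A, Complex.exp (k x) = 1) {x x' : X}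
    (hx : x ∈ A) (hx' : x' ∈ A) : k x = k x' := by
  classical
  have hne : ∀ y ∈ K, ∃ x ∈ A, f x = y := by
    intro y hy
    obtain ⟨σ, -, h⟩ := hsec y hy
    have := h.self_of_nhdsWithin hy
    exact ⟨σ y, this⟩
  have : Nonempty X := ⟨x⟩
  choose! s hs hfs using hne
  -- Constancy on fibres lets `k` descend to the base through the arbitrary choice `s`. The local
  -- sections serve only to show that the descended function is continuous.
  have hfibeq : ∀ x ∈ A, k x = k (s (f x)) := fun x hx =>
    eq_of_exp_eq_one (hfib (f x) (hfA hx)) (hk.mono inter_subset_left) (fun x hx => h1 x hx.1)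
      ⟨hx, rfl⟩ ⟨hs _ (hfA hx), hfs _ (hfA hx)⟩
  have hcont : ContinuousOn (fun y => k (s y)) K := by
    intro y hy
    obtain ⟨σ, hσ, h⟩ := hsec y hy
    have hyA := (h.self_of_nhdsWithin hy).1
    have hc : ContinuousWithinAt (fun y' => k (σ y')) K y := by
      have h2 : Tendsto σ (𝓝[K] y) (𝓝[A] (σ y)) := by
        refine tendsto_nhdsWithin_iff.2 ⟨hσ.mono_left nhdsWithin_le_nhds, h.mono fun _ h => h.1⟩
      exact (hk _ hyA).tendsto.comp h2
    refine hc.congr_of_eventuallyEq ?_ ?_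
    · filter_upwards [h] with y' hy'
      rw [hfibeq _ hy'.1, hy'.2]
    · have := h.self_of_nhdsWithin hy
      rw [hfibeq _ this.1, this.2]
  rw [hfibeq x hx, hfibeq x' hx']
  exact eq_of_exp_eq_one hK hcont (fun y hy => h1 _ (hs y hy)) (hfA hx) (hfA hx')

theorem exists_log_of_continuousOn_disc {F : ℂ → ℂ} (hF : ContinuousOn F disc)
    (h0 : ∀ ζ ∈ disc, F ζ ≠ 0) :
    ∃ l : ℂ → ℂ, ContinuousOn l disc ∧ ∀ ζ ∈ disc, Complex.exp (l ζ) = F ζ := by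
  have hsc : IsSimplyConnected disc := by
    have : ContractibleSpace disc :=
      (convex_ball (0 : ℂ) 1).contractibleSpace ⟨0, mem_ball_self one_pos⟩
    exact SimplyConnectedSpace.ofContractible disc
  obtain ⟨l, hl, h⟩ := Complex.exists_continuousOn_eqOn_exp_comp hsc isOpen_ball hF
    (by rintro ⟨ζ, hζ, h⟩; exact h0 ζ hζ h)
  exact ⟨l, hl, fun ζ hζ => h hζ⟩

theorem BiholomorphicToDisc.isPathConnected {S : Set ℂ} (h : BiholomorphicToDisc S) :
    IsPathConnected S := by
  obtain ⟨f, g, hf, hg, hfS, hgS, hgf, hfg⟩ := h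
  have : S = g '' disc := by
    ext ζ
    exact ⟨fun h => ⟨f ζ, hfS h, hgf h⟩, by rintro ⟨w, hw, rfl⟩; exact hgS hw⟩
  rw [this]
  exact ((convex_ball (0 : ℂ) 1).isPathConnected ⟨0, mem_ball_self one_pos⟩).image'
    hg.continuousOn

theorem BiholomorphicToDisc.exists_log {S : Set ℂ} (h : BiholomorphicToDisc S) {F : ℂ → ℂ}
    (hF : ContinuousOn F S) (h0 : ∀ ζ ∈ S, F ζ ≠ 0) :
    ∃ l : ℂ → ℂ, ContinuousOn l S ∧ ∀ ζ ∈ S, Complex.exp (l ζ) = F ζ := by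
  obtain ⟨f, g, hf, hg, hfS, hgS, hgf, hfg⟩ := h
  obtain ⟨l, hl, hl1⟩ := exists_log_of_continuousOn_disc (hF.comp hg.continuousOn hgS)
    fun ζ hζ => h0 _ (hgS hζ)
  refine ⟨l ∘ f, hl.comp hf.continuousOn hfS, fun ζ hζ => ?_⟩
  have := hl1 (f ζ) (hfS hζ)
  simp only [Function.comp] at this ⊢
  rw [this, hgf hζ]

variable {n : ℕ} {D : Set (Cn n)}

/-- On slices of `D` by complex lines, depending continuously on a parameter `y`, a nonvanishing
affine function `ζ ↦ 1 + ζ β y` has a logarithm at `ζ = 1`, normalised at `ζ = 0`, which depends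
continuously on `y`. -/
theorem IsCConvexDomainWithoutLines.exists_continuous_log (hD : IsCConvexDomainWithoutLines D)
    {Y : Type*} [TopologicalSpace Y] {b v : Y → Cn n} {β : Y → ℂ} (hb : Continuous b)
    (hv : Continuous v) (hβ : Continuous β) (hbD : ∀ y, b y ∈ D) (hvD : ∀ y, b y + v y ∈ D)
    (h0 : ∀ y, ∀ ζ : ℂ, b y + ζ • v y ∈ D → 1 + ζ * β y ≠ 0) :
    ∃ L : Y → ℂ, Continuous L ∧ (∀ y, Complex.exp (L y) = 1 + β y) ∧ ∀ y, v y = 0 → L y = 0 := by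
  classical
  have hS : ∀ y, v y ≠ 0 → BiholomorphicToDisc {ζ : ℂ | b y + ζ • v y ∈ D} := fun y hy =>
    hD.slice _ _ hy ⟨0, by simpa using hbD y⟩
  -- For `v y = 0` the slice is all of ℂ, where a nonvanishing affine function is constant.
  have hβ0 : ∀ y, v y = 0 → β y = 0 := by
    intro y hy
    by_contra hne
    refine h0 y (-(β y)⁻¹) (by simpa [hy] using hbD y) ?_
    field_simp
    simp
  have hpc : ∀ y, IsPathConnected {ζ : ℂ | b y + ζ • v y ∈ D} := by
    intro y
    by_cases hy : v y = 0
    · have : {ζ : ℂ | b y + ζ • v y ∈ D} = univ := by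
        ext ζ; simp [hy, hbD y]
      rw [this]
      exact isPathConnected_univ
    · exact (hS y hy).isPathConnected
  have hlog : ∀ y, ∃ l : ℂ → ℂ, ContinuousOn l {ζ : ℂ | b y + ζ • v y ∈ D} ∧ l 0 = 0 ∧
      (∀ ζ : ℂ, b y + ζ • v y ∈ D → Complex.exp (l ζ) = 1 + ζ * β y) ∧ (v y = 0 → l 1 = 0) := by
    intro y
    by_cases hy : v y = 0
    · exact ⟨fun _ => 0, continuousOn_const, rfl, fun ζ _ => by simp [hβ0 y hy], fun _ => rfl⟩
    · obtain ⟨l, hl, hl1⟩ := (hS y hy).exists_log (F := fun ζ => 1 + ζ * β y) (by fun_prop)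
        (fun ζ hζ => h0 y ζ hζ)
      have hz : (0 : ℂ) ∈ {ζ : ℂ | b y + ζ • v y ∈ D} := by simpa using hbD y
      refine ⟨fun ζ => l ζ - l 0, hl.sub continuousOn_const, by simp, fun ζ hζ => ?_,
        fun h => absurd h hy⟩
      rw [Complex.exp_sub, hl1 ζ hζ, hl1 0 hz]
      simp
  choose l hl hl0 hl1 hlv using hlog
  -- The branches on different slices were chosen independently. A path from 0 to 1 in the slice of
  -- `y₀` also lies in the nearby slices, by compactness, and along it the ratio of the two affine
  -- functions stays within 1 of 1. The two branches therefore differ by the principal logarithm of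
  -- the ratio, with no additive constant because both vanish at 0.
  have key : ∀ y₀, ∀ᶠ y in 𝓝 y₀,
      l y 1 = l y₀ 1 + Complex.log ((1 + β y) / (1 + β y₀)) := by
    intro y₀
    obtain ⟨γ, hγ⟩ := (hpc y₀).joinedIn 0 (by simpa using hbD y₀) 1 (by simpa using hvD y₀)
    set U : Set (Y × ℂ) := {p | b p.1 + p.2 • v p.1 ∈ D ∧ 1 + p.2 * β y₀ ≠ 0 ∧
      (1 + p.2 * β p.1) / (1 + p.2 * β y₀) ∈ ball (1 : ℂ) 1} with hU
    have hUo : IsOpen U := by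
      have h1 : IsOpen {p : Y × ℂ | b p.1 + p.2 • v p.1 ∈ D ∧ 1 + p.2 * β y₀ ≠ 0} :=
        (hD.isOpen.preimage (by fun_prop)).inter (isOpen_ne_fun (by fun_prop) (by fun_prop))
      have h2 : ContinuousOn (fun p : Y × ℂ => (1 + p.2 * β p.1) / (1 + p.2 * β y₀))
          {p : Y × ℂ | b p.1 + p.2 • v p.1 ∈ D ∧ 1 + p.2 * β y₀ ≠ 0} :=
        ContinuousOn.div (by fun_prop) (by fun_prop) fun p hp => hp.2
      have h3 := h2.isOpen_inter_preimage h1 (isOpen_ball (x := (1 : ℂ)) (ε := 1))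
      convert h3 using 1
      ext p
      simp only [hU, mem_ofPred_eq, mem_inter_iff, mem_preimage, and_assoc]
    have hK : IsCompact (range γ) := isCompact_range γ.continuous
    have hsub : {y₀} ×ˢ range γ ⊆ U := by
      rintro ⟨y, ζ⟩ ⟨hy, t, rfl⟩
      rw [mem_singleton_iff] at hy
      dsimp only at hy
      subst hy
      have hne := h0 y (γ t) (hγ t)
      refine ⟨hγ t, hne, ?_⟩
      dsimp only
      rw [div_self hne]
      exact mem_ball_self one_pos
    obtain ⟨V, W, hV, hW, hyV, hγW, hVW⟩ := generalized_tube_lemma isCompact_singleton hK hUo hsub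
    filter_upwards [hV.mem_nhds (hyV rfl)] with y hy
    have hmem : ∀ t, (y, γ t) ∈ U := fun t => hVW ⟨hy, hγW ⟨t, rfl⟩⟩
    have hslit : ∀ t, (1 + γ t * β y) / (1 + γ t * β y₀) ∈ Complex.slitPlane := fun t =>
      Complex.ball_one_subset_slitPlane (hmem t).2.2
    have hc : Continuous fun t => l y (γ t) - l y₀ (γ t) -
        Complex.log ((1 + γ t * β y) / (1 + γ t * β y₀)) := by
      refine ((((hl y).comp_continuous γ.continuous fun t => (hmem t).1).sub
        ((hl y₀).comp_continuous γ.continuous hγ)).sub ?_)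
      exact Continuous.clog (Continuous.div (by fun_prop) (by fun_prop) fun t => (hmem t).2.1) hslit
    have h := eq_of_exp_eq_one (isPreconnected_univ (α := unitInterval)) hc.continuousOn
      (fun t _ => by
        have hne := h0 y (γ t) (hmem t).1
        rw [Complex.exp_sub, Complex.exp_sub, hl1 y _ (hmem t).1, hl1 y₀ _ (hγ t),
          Complex.exp_log (div_ne_zero hne (hmem t).2.1)]
        exact div_self (div_ne_zero hne (hmem t).2.1)) (mem_univ 1) (mem_univ 0)
    simp only [Path.target, Path.source, one_mul, zero_mul, hl0, add_zero, div_one, Complex.log_one,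
      sub_zero] at h
    linear_combination h
  refine ⟨fun y => l y 1, ?_, fun y => ?_, fun y hy => hlv y hy⟩
  · rw [continuous_iff_continuousAt]
    intro y₀
    have hne : 1 + β y₀ ≠ 0 := by simpa using h0 y₀ 1 (by simpa using hvD y₀)
    refine ContinuousAt.congr ?_ (EventuallyEq.symm (key y₀))
    refine continuousAt_const.add (ContinuousAt.clog ?_ ?_)
    · exact ContinuousAt.div_const (by fun_prop) _
    · rw [div_self hne]; exact Complex.one_mem_slitPlane
  · simpa using hl1 y 1 (by simpa using hvD y)

/-- Intersections of `D` with complex affine subspaces are preconnected. -/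
theorem IsCConvexDomainWithoutLines.isPreconnected_inter (hD : IsCConvexDomainWithoutLines D)
    {P : Set (Cn n)} (hP : ∀ p ∈ P, ∀ q ∈ P, ∀ ζ : ℂ, p + ζ • (q - p) ∈ P) :
    IsPreconnected (D ∩ P) := by
  refine isPreconnected_of_forall_pair fun p hp q hq => ?_
  by_cases hpq : q - p = 0
  · refine ⟨{p}, by simpa using hp, rfl, (sub_eq_zero.1 hpq), isPreconnected_singleton⟩
  · have hS := (hD.slice p (q - p) hpq ⟨0, by simpa using hp.1⟩).isPathConnected.isConnected.2
    refine ⟨(fun ζ : ℂ => p + ζ • (q - p)) '' {ζ : ℂ | p + ζ • (q - p) ∈ D}, ?_, ⟨0, ?_, by simp⟩,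
      ⟨1, ?_, by simp⟩, hS.image _ (by fun_prop)⟩
    · rintro _ ⟨ζ, hζ, rfl⟩
      exact ⟨hζ, hP p hp.2 q hq.2 ζ⟩
    · simpa using hp.1
    · simpa using hq.1

end Slices
-- Linear convexity: hyperplanes through points outside the domain
section LinearConvexity

/-- A property of intervals which is additive and holds for short intervals holds for all. -/
theorem interval_induction {P : ℝ → ℝ → Prop} {A B δ : ℝ} (hδ : 0 < δ)
    (hglue : ∀ a b c, A ≤ a → a ≤ b → b ≤ c → c ≤ B → P a b → P b c → P a c)
    (hsmall : ∀ a b, A ≤ a → a ≤ b → b ≤ B → b - a < δ → P a b) (hAB : A ≤ B) : P A B := by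
  have main : ∀ k : ℕ, ∀ a b, A ≤ a → a ≤ b → b ≤ B → b - a ≤ k * (δ / 2) → P a b := by
    intro k
    induction k with
    | zero =>
      intro a b h1 h2 h3 h4
      exact hsmall a b h1 h2 h3 (by push_cast at h4; linarith)
    | succ k ih =>
      intro a b h1 h2 h3 h4
      push_cast at h4
      by_cases h : b - a < δ
      · exact hsmall a b h1 h2 h3 h
      · refine hglue a (b - δ / 2) b h1 (by linarith) (by linarith) h3
          (ih _ _ h1 (by linarith) (by linarith) (by linarith))
          (hsmall _ _ (by linarith) (by linarith) h3 (by linarith))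
  obtain ⟨k, hk⟩ := exists_nat_ge ((B - A) / (δ / 2))
  exact main k A B le_rfl hAB le_rfl ((div_le_iff₀ (by linarith)).1 hk)

variable {n : ℕ} {D : Set (Cn n)} {W : Submodule ℂ (Cn n)} {u₁ u₂ : Cn n}
  {z₁ z₂ : Cn n →L[ℂ] ℂ}

/-- The points of `D` in the span of `W`, `u₁`, `u₂` whose slope `z₂ / z₁` lies in `K`. -/
def slopeSet (D : Set (Cn n)) (W : Submodule ℂ (Cn n)) (u₁ u₂ : Cn n) (z₁ z₂ : Cn n →L[ℂ] ℂ)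
    (K : Set ℂ) : Set (Cn n) :=
  {q | q ∈ D ∧ q - z₁ q • u₁ - z₂ q • u₂ ∈ W ∧ z₁ q ≠ 0 ∧ z₂ q / z₁ q ∈ K}

/-- Over the slopes in `K` there is a continuous branch of `log z₁`. -/
def HasLogOver (D : Set (Cn n)) (W : Submodule ℂ (Cn n)) (u₁ u₂ : Cn n) (z₁ z₂ : Cn n →L[ℂ] ℂ)
    (K : Set ℂ) : Prop :=
  ∃ L : Cn n → ℂ, ContinuousOn L (slopeSet D W u₁ u₂ z₁ z₂ K) ∧
    ∀ q ∈ slopeSet D W u₁ u₂ z₁ z₂ K, Complex.exp (L q) = z₁ q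

/-- Two functionals vanishing on `W` and dual to `u₁`, `u₂`. -/
structure IsDualPair (W : Submodule ℂ (Cn n)) (u₁ u₂ : Cn n) (z₁ z₂ : Cn n →L[ℂ] ℂ) : Prop where
  fst_zero : ∀ w ∈ W, z₁ w = 0
  snd_zero : ∀ w ∈ W, z₂ w = 0
  fst_fst : z₁ u₁ = 1
  fst_snd : z₁ u₂ = 0
  snd_fst : z₂ u₁ = 0
  snd_snd : z₂ u₂ = 1

theorem HasLogOver.mono {K K' : Set ℂ} (h : HasLogOver D W u₁ u₂ z₁ z₂ K') (hK : K ⊆ K') :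
    HasLogOver D W u₁ u₂ z₁ z₂ K := by
  obtain ⟨L, hL, hL1⟩ := h
  have hsub : slopeSet D W u₁ u₂ z₁ z₂ K ⊆ slopeSet D W u₁ u₂ z₁ z₂ K' := fun q hq =>
    ⟨hq.1, hq.2.1, hq.2.2.1, hK hq.2.2.2⟩
  exact ⟨L, hL.mono hsub, fun q hq => hL1 q (hsub hq)⟩

theorem continuousAt_slope {q : Cn n} (h : z₁ q ≠ 0) : ContinuousAt (fun q => z₂ q / z₁ q) q :=
  ContinuousAt.div (by fun_prop) (by fun_prop) h

/-- Every slope has a continuous local section. -/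
theorem exists_section (hD : IsOpen D) (hz : IsDualPair W u₁ u₂ z₁ z₂)
    (hhit : ∀ α β : ℂ, α ≠ 0 ∨ β ≠ 0 → ∃ w ∈ W, ∃ c : ℂ, c ≠ 0 ∧ w + c • (α • u₁ + β • u₂) ∈ D)
    (t₀ : ℂ) : ∃ w ∈ W, ∃ c : ℂ, c ≠ 0 ∧ ∃ ε > 0, ∀ t ∈ ball t₀ ε,
      w + c • (u₁ + t • u₂) ∈ slopeSet D W u₁ u₂ z₁ z₂ {t} ∧ z₁ (w + c • (u₁ + t • u₂)) = c := by
  obtain ⟨w, hw, c, hc, hwc⟩ := hhit 1 t₀ (Or.inl one_ne_zero)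
  have hopen : IsOpen {t : ℂ | w + c • (u₁ + t • u₂) ∈ D} := hD.preimage (by fun_prop)
  obtain ⟨ε, hε, hεs⟩ := Metric.isOpen_iff.1 hopen t₀ (by simpa using hwc)
  refine ⟨w, hw, c, hc, ε, hε, fun t ht => ?_⟩
  have e1 : z₁ (w + c • (u₁ + t • u₂)) = c := by
    simp [hz.fst_zero w hw, hz.fst_fst, hz.fst_snd]
  have e2 : z₂ (w + c • (u₁ + t • u₂)) = c * t := by
    simp [hz.snd_zero w hw, hz.snd_fst, hz.snd_snd]
  refine ⟨⟨hεs ht, ?_, ?_, ?_⟩, e1⟩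
  · rw [e1, e2]
    convert hw using 1
    module
  · rwa [e1]
  · rw [e1, e2, mem_singleton_iff]
    field_simp

/-- If `z₁ q` vanished, so would `z₂ q`, which would put `q` in `W`. -/
theorem mem_of_slope_zero (hDW : ∀ w ∈ W, w ∉ D) {q : Cn n}
    (hq : q ∈ D) (hW : q - z₁ q • u₁ - z₂ q • u₂ ∈ W) {t : ℂ} (ht : z₂ q = t * z₁ q) :
    z₁ q ≠ 0 := by
  intro h
  rw [h, mul_zero] at ht
  rw [h, ht] at hW
  exact hDW q (by simpa using hW) hq

/-- Over `K ∩ K'` the two branches differ by a function with values in the kernel of `exp`. It is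
constant because the slope map has preconnected fibres, each the trace of `D` on a linear subspace,
as well as local sections over a preconnected base. Shifting one branch by this constant makes them
agree on the overlap. -/
theorem HasLogOver.glue (hD : IsCConvexDomainWithoutLines D) (hDW : ∀ w ∈ W, w ∉ D)
    (hz : IsDualPair W u₁ u₂ z₁ z₂)
    (hhit : ∀ α β : ℂ, α ≠ 0 ∨ β ≠ 0 → ∃ w ∈ W, ∃ c : ℂ, c ≠ 0 ∧ w + c • (α • u₁ + β • u₂) ∈ D)
    {K K' : Set ℂ} (hK : IsClosed K) (hK' : IsClosed K') (hKK' : IsPreconnected (K ∩ K'))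
    (h : HasLogOver D W u₁ u₂ z₁ z₂ K) (h' : HasLogOver D W u₁ u₂ z₁ z₂ K') :
    HasLogOver D W u₁ u₂ z₁ z₂ (K ∪ K') := by
  classical
  obtain ⟨L, hL, hL1⟩ := h
  obtain ⟨L', hL', hL1'⟩ := h'
  set A := slopeSet D W u₁ u₂ z₁ z₂ with hA
  have hsub : ∀ {K K' : Set ℂ}, K ⊆ K' → A K ⊆ A K' := fun hKK q hq =>
    ⟨hq.1, hq.2.1, hq.2.2.1, hKK hq.2.2.2⟩
  have hconst : ∃ c : ℂ, Complex.exp c = 1 ∧ ∀ q ∈ A (K ∩ K'), L q = L' q + c := by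
    by_cases hne : (A (K ∩ K')).Nonempty
    swap
    · exact ⟨0, Complex.exp_zero, fun q hq => absurd ⟨q, hq⟩ hne⟩
    obtain ⟨q₀, hq₀⟩ := hne
    have hexp : ∀ q ∈ A (K ∩ K'), Complex.exp (L q - L' q) = 1 := by
      intro q hq
      rw [Complex.exp_sub, hL1 q (hsub inter_subset_left hq),
        hL1' q (hsub inter_subset_right hq), div_self hq.2.2.1]
    refine ⟨L q₀ - L' q₀, hexp q₀ hq₀, fun q hq => ?_⟩
    have := eq_of_exp_eq_one_of_fibers (A := A (K ∩ K')) (f := fun q => z₂ q / z₁ q) hKK'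
      (fun q hq => hq.2.2.2) ?_ ?_ (k := fun q => L q - L' q)
      ((hL.mono (hsub inter_subset_left)).sub (hL'.mono (hsub inter_subset_right))) hexp hq hq₀
    · linear_combination this
    · intro t ht
      have heq : A (K ∩ K') ∩ (fun q => z₂ q / z₁ q) ⁻¹' {t} =
          D ∩ {q | q - z₁ q • u₁ - z₂ q • u₂ ∈ W ∧ z₂ q = t * z₁ q} := by
        ext q
        constructor
        · rintro ⟨hq, hqt⟩
          refine ⟨hq.1, hq.2.1, ?_⟩
          rw [mem_preimage, mem_singleton_iff] at hqt
          rw [← hqt, div_mul_cancel₀ _ hq.2.2.1]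
        · rintro ⟨hq, hqW, hqt⟩
          have h1 := mem_of_slope_zero hDW hq hqW hqt
          have h2 : z₂ q / z₁ q = t := by rw [hqt, mul_div_cancel_right₀ _ h1]
          exact ⟨⟨hq, hqW, h1, h2 ▸ ht⟩, h2⟩
      rw [heq]
      refine hD.isPreconnected_inter ?_
      rintro p ⟨hpW, hpt⟩ q ⟨hqW, hqt⟩ ζ
      constructor
      · have := W.add_mem hpW (W.smul_mem ζ (W.sub_mem hqW hpW))
        convert this using 1
        simp only [map_add, map_smul, map_sub, smul_eq_mul]
        module
      · simp only [map_add, map_smul, map_sub, smul_eq_mul, hpt, hqt]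
        ring
    · intro t ht
      obtain ⟨w, hw, c, hc, ε, hε, hs⟩ := exists_section hD.isOpen hz hhit t
      refine ⟨fun t => w + c • (u₁ + t • u₂), by fun_prop, ?_⟩
      filter_upwards [self_mem_nhdsWithin, mem_nhdsWithin_of_mem_nhds (ball_mem_nhds t hε)]
        with t' ht' hb
      have := (hs t' hb).1
      exact ⟨hsub (singleton_subset_iff.2 ht') this, this.2.2.2⟩
  obtain ⟨c, hc, hcq⟩ := hconst
  -- Near a point whose slope is outside the closed set `K` there are no points with slope in `K`,
  -- so continuity within that set is vacuous there.
  have hclosed : ∀ {K : Set ℂ}, IsClosed K → ∀ q, z₁ q ≠ 0 → q ∉ A K → q ∈ D →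
      q - z₁ q • u₁ - z₂ q • u₂ ∈ W → ∀ f : Cn n → ℂ, ContinuousWithinAt f (A K) q := by
    intro K hK q hq hqA hqD hqW f
    have hqK : z₂ q / z₁ q ∈ Kᶜ := fun h => hqA ⟨hqD, hqW, hq, h⟩
    have : ∀ᶠ q' in 𝓝 q, q' ∉ A K := by
      filter_upwards [(continuousAt_slope (z₂ := z₂) hq).eventually (hK.isOpen_compl.mem_nhds hqK)]
        with q' h' hq'
      exact h' hq'.2.2.2
    have hbot : 𝓝[A K] q = ⊥ := by
      rw [← Filter.empty_mem_iff_bot, mem_nhdsWithin_iff_eventually]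
      exact this
    rw [ContinuousWithinAt, hbot]
    exact tendsto_bot
  refine ⟨(A K).piecewise L fun q => L' q + c, ?_, ?_⟩
  · intro q hq
    have hun : A (K ∪ K') ⊆ A K ∪ A K' := by
      rintro q ⟨h1, h2, h3, h4 | h4⟩
      exacts [Or.inl ⟨h1, h2, h3, h4⟩, Or.inr ⟨h1, h2, h3, h4⟩]
    refine ContinuousWithinAt.mono (ContinuousWithinAt.union ?_ ?_) hun
    · by_cases hqK : q ∈ A K
      · exact (hL q hqK).congr (fun y hy => piecewise_eq_of_mem _ _ _ hy)
          (piecewise_eq_of_mem _ _ _ hqK)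
      · exact hclosed hK q hq.2.2.1 hqK hq.1 hq.2.1 _
    · by_cases hqK : q ∈ A K'
      · have heq : ∀ y ∈ A K', (A K).piecewise L (fun q => L' q + c) y = L' y + c := by
          intro y hy
          by_cases hyK : y ∈ A K
          · rw [piecewise_eq_of_mem _ _ _ hyK]
            exact hcq y ⟨hy.1, hy.2.1, hy.2.2.1, hyK.2.2.2, hy.2.2.2⟩
          · rw [piecewise_eq_of_notMem _ _ _ hyK]
        exact ((hL' q hqK).add continuousWithinAt_const).congr heq (heq q hqK)
      · exact hclosed hK' q hq.2.2.1 hqK hq.1 hq.2.1 _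
  · intro q hq
    by_cases hqK : q ∈ A K
    · rw [piecewise_eq_of_mem _ _ _ hqK, hL1 q hqK]
    · rw [piecewise_eq_of_notMem _ _ _ hqK, Complex.exp_add, hc, mul_one]
      refine hL1' q ⟨hq.1, hq.2.1, hq.2.2.1, hq.2.2.2.resolve_left fun h => hqK ?_⟩
      exact ⟨hq.1, hq.2.1, hq.2.2.1, h⟩

/-- Each point is joined by a complex line to the point of the local section with the same slope.
The slope is constant along this line, so `z₁` does not vanish on its part in `D`, and
`exists_continuous_log` continues the logarithm from the section, where `z₁` is the constant `c`. -/
theorem exists_hasLogOver_ball (hD : IsCConvexDomainWithoutLines D) (hDW : ∀ w ∈ W, w ∉ D)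
    (hz : IsDualPair W u₁ u₂ z₁ z₂)
    (hhit : ∀ α β : ℂ, α ≠ 0 ∨ β ≠ 0 → ∃ w ∈ W, ∃ c : ℂ, c ≠ 0 ∧ w + c • (α • u₁ + β • u₂) ∈ D)
    (t₀ : ℂ) : ∃ ε > 0, HasLogOver D W u₁ u₂ z₁ z₂ (ball t₀ ε) := by
  classical
  obtain ⟨w, hw, c, hc, ε, hε, hs⟩ := exists_section hD.isOpen hz hhit t₀
  refine ⟨ε, hε, ?_⟩
  set A := slopeSet D W u₁ u₂ z₁ z₂ (ball t₀ ε)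
  let t : A → ℂ := fun q => z₂ q / z₁ q
  have ht : Continuous t := Continuous.div (by fun_prop) (by fun_prop) fun q => q.2.2.2.1
  have hb : ∀ q : A, z₁ (w + c • (u₁ + t q • u₂)) = c := fun q => (hs (t q) q.2.2.2.2).2
  have hbS : ∀ q : A, w + c • (u₁ + t q • u₂) ∈ slopeSet D W u₁ u₂ z₁ z₂ {t q} :=
    fun q => (hs (t q) q.2.2.2.2).1
  obtain ⟨L, hL, hL1, -⟩ := hD.exists_continuous_log (Y := A)
    (b := fun q => w + c • (u₁ + t q • u₂)) (v := fun q => q - (w + c • (u₁ + t q • u₂)))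
    (β := fun q => (z₁ q - c) / c) (by fun_prop) (by fun_prop) (by fun_prop)
    (fun q => (hbS q).1) (fun q => by simpa using q.2.1) (by
      intro q ζ hζ h0
      have e1 : z₁ (w + c • (u₁ + t q • u₂) + ζ • (q - (w + c • (u₁ + t q • u₂)))) =
          c * (1 + ζ * ((z₁ q - c) / c)) := by
        rw [map_add, map_smul, map_sub, hb, smul_eq_mul]
        field_simp
      have eb : z₂ (w + c • (u₁ + t q • u₂)) = t q * z₁ (w + c • (u₁ + t q • u₂)) := by
        have := (hbS q).2.2.2
        rw [mem_singleton_iff] at this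
        rw [← div_mul_cancel₀ (z₂ (w + c • (u₁ + t q • u₂))) (hbS q).2.2.1, this]
      have eq2 : z₂ (q : Cn n) = t q * z₁ q := by
        simp only [t]
        rw [div_mul_cancel₀ _ q.2.2.2.1]
      refine mem_of_slope_zero (W := W) (u₁ := u₁) (u₂ := u₂) (z₁ := z₁) (z₂ := z₂) (t := t q)
        hDW hζ ?_ ?_ (by rw [e1, h0, mul_zero])
      · have h1 := (hbS q).2.1
        have h2 := q.2.2.1
        have := W.add_mem h1 (W.smul_mem ζ (W.sub_mem h2 h1))
        convert this using 1
        simp only [map_add, map_smul, map_sub, smul_eq_mul]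
        module
      · rw [map_add, map_smul, map_sub, map_add z₁, map_smul z₁, map_sub z₁, eb, eq2]
        simp only [smul_eq_mul]
        ring)
  refine ⟨fun q => if h : q ∈ A then L ⟨q, h⟩ + Complex.log c else 0, ?_, ?_⟩
  · rw [continuousOn_iff_continuous_domRestrict]
    convert hL.add_const (Complex.log c) using 1
    ext q
    simp
  · intro q hq
    simp only [dif_pos (show q ∈ A from hq)]
    rw [Complex.exp_add, hL1, Complex.exp_log hc]
    field_simp
    ring

/-- The closed rectangle with the given sides. -/
def rect (a b c d : ℝ) : Set ℂ := Icc a b ×ℂ Icc c d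

theorem isClosed_rect (a b c d : ℝ) : IsClosed (rect a b c d) := isClosed_Icc.reProdIm isClosed_Icc

theorem isPreconnected_rect (a b c d : ℝ) : IsPreconnected (rect a b c d) :=
  (((convex_Icc a b).linear_preimage Complex.reLm).inter
    ((convex_Icc c d).linear_preimage Complex.imLm)).isPreconnected

/-- Squares below the Lebesgue number are glued into vertical strips, and the strips into the whole
square. Consecutive pieces meet in a segment or a point, or not at all, so the overlap is
preconnected. Sides below `δ / 2` suffice because the norm is at most |re| + |im|. -/
theorem hasLogOver_rect (hD : IsCConvexDomainWithoutLines D) (hDW : ∀ w ∈ W, w ∉ D)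
    (hz : IsDualPair W u₁ u₂ z₁ z₂)
    (hhit : ∀ α β : ℂ, α ≠ 0 ∨ β ≠ 0 → ∃ w ∈ W, ∃ c : ℂ, c ≠ 0 ∧ w + c • (α • u₁ + β • u₂) ∈ D)
    {A B : ℝ} (hAB : A ≤ B) : HasLogOver D W u₁ u₂ z₁ z₂ (rect A B A B) := by
  choose ε hε hball using exists_hasLogOver_ball hD hDW hz hhit
  have hcomp : IsCompact (rect A B A B) := isCompact_Icc.reProdIm isCompact_Icc
  obtain ⟨δ, hδ, hLeb⟩ := lebesgue_number_lemma_of_metric hcomp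
    (c := fun t => ball t (ε t)) (fun t => isOpen_ball)
    (fun t _ => mem_iUnion.2 ⟨t, mem_ball_self (hε t)⟩)
  refine interval_induction (P := fun a b => HasLogOver D W u₁ u₂ z₁ z₂ (rect a b A B))
    (half_pos hδ) ?_ ?_ hAB
  · intro a b c _ h1 h2 _ h3 h4
    have hun : rect a c A B ⊆ rect a b A B ∪ rect b c A B := by
      rintro t ⟨⟨h5, h6⟩, h7⟩
      rcases le_total t.re b with h | h
      exacts [Or.inl ⟨⟨h5, h⟩, h7⟩, Or.inr ⟨⟨h, h6⟩, h7⟩]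
    refine (HasLogOver.glue hD hDW hz hhit (isClosed_rect _ _ _ _) (isClosed_rect _ _ _ _) ?_
      h3 h4).mono hun
    convert isPreconnected_rect b b A B using 1
    ext t
    simp only [rect, Complex.mem_reProdIm, mem_inter_iff, mem_Icc]
    constructor <;> rintro h <;> refine ⟨?_, ?_⟩ <;> grind
  · intro a b ha hab hb hs
    refine interval_induction (P := fun c d => HasLogOver D W u₁ u₂ z₁ z₂ (rect a b c d))
      (half_pos hδ) ?_ ?_ hAB
    · intro c d e _ h1 h2 _ h3 h4
      have hun : rect a b c e ⊆ rect a b c d ∪ rect a b d e := by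
        rintro t ⟨h7, ⟨h5, h6⟩⟩
        rcases le_total t.im d with h | h
        exacts [Or.inl ⟨h7, ⟨h5, h⟩⟩, Or.inr ⟨h7, ⟨h, h6⟩⟩]
      refine (HasLogOver.glue hD hDW hz hhit (isClosed_rect _ _ _ _) (isClosed_rect _ _ _ _) ?_
        h3 h4).mono hun
      convert isPreconnected_rect a b d d using 1
      ext t
      simp only [rect, Complex.mem_reProdIm, mem_inter_iff, mem_Icc]
      constructor <;> rintro h <;> refine ⟨?_, ?_⟩ <;> grind
    · intro c d hc hcd hd hs'
      obtain ⟨t, ht⟩ := hLeb ⟨a, c⟩ ⟨⟨ha, hab.trans hb⟩, ⟨hc, hcd.trans hd⟩⟩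
      refine (hball t).mono (Subset.trans ?_ ht)
      rintro s ⟨⟨h1, h2⟩, ⟨h3, h4⟩⟩
      rw [mem_ball, dist_eq_norm]
      refine (Complex.norm_le_abs_re_add_abs_im _).trans_lt ?_
      rw [Complex.sub_re, Complex.sub_im, abs_of_nonneg (by simpa using h1),
        abs_of_nonneg (by simpa using h3)]
      dsimp only
      linarith

/-- The infinite slope is hit too, at a point `w + c • u₂`. A small circle around it in the
direction `u₁` lies in `D` and consists of points of finite slope. Along this circle `z₁` winds
around 0, which excludes a branch of its logarithm. -/
theorem not_forall_slope_hit (hD : IsCConvexDomainWithoutLines D) (hDW : ∀ w ∈ W, w ∉ D)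
    (hz : IsDualPair W u₁ u₂ z₁ z₂) :
    ¬ ∀ α β : ℂ, α ≠ 0 ∨ β ≠ 0 → ∃ w ∈ W, ∃ c : ℂ, c ≠ 0 ∧ w + c • (α • u₁ + β • u₂) ∈ D := by
  intro hhit
  obtain ⟨w, hw, c, hc, hwc⟩ := hhit 0 1 (Or.inr one_ne_zero)
  have hopen : IsOpen {s : ℂ | w + c • (s • u₁ + u₂) ∈ D} := hD.isOpen.preimage (by fun_prop)
  obtain ⟨ε, hε, hεs⟩ := Metric.isOpen_iff.1 hopen 0 (by simpa using hwc)
  -- The circle has radius `R⁻¹ = ε / 2`, inside the disc that stays in `D`. Its slopes have modulus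
  -- `R`, so they lie in the square of half-side `R`.
  set R : ℝ := 2 / ε with hR
  have hR0 : 0 < R := by positivity
  obtain ⟨L, hL, hL1⟩ := hasLogOver_rect hD hDW hz hhit (A := -R) (B := R) (by linarith)
  let s : ℝ → ℂ := fun θ => (R : ℂ)⁻¹ * Complex.exp (-(θ * Complex.I))
  let q : ℝ → Cn n := fun θ => w + c • (s θ • u₁ + u₂)
  have hs : ∀ θ, ‖s θ‖ = R⁻¹ := by
    intro θ
    have : ‖Complex.exp (-(θ * Complex.I))‖ = 1 := by
      have := Complex.norm_exp_ofReal_mul_I (-θ)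
      simpa using this
    simp [s, this, abs_of_pos hR0]
  have hs0 : ∀ θ, s θ ≠ 0 := fun θ => by
    rw [← norm_pos_iff, hs]; positivity
  have e1 : ∀ θ, z₁ (q θ) = c * s θ := fun θ => by
    simp [q, hz.fst_zero w hw, hz.fst_fst, hz.fst_snd]
  have e2 : ∀ θ, z₂ (q θ) = c := fun θ => by
    simp [q, hz.snd_zero w hw, hz.snd_fst, hz.snd_snd]
  have hq : ∀ θ, q θ ∈ slopeSet D W u₁ u₂ z₁ z₂ (rect (-R) R (-R) R) := by
    intro θ
    refine ⟨hεs ?_, ?_, ?_, ?_⟩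
    · rw [mem_ball_zero_iff, hs, hR, inv_div]
      linarith
    · rw [e1, e2]
      convert hw using 1
      simp only [q]
      module
    · rw [e1]
      exact mul_ne_zero hc (hs0 θ)
    · have hn : ‖z₂ (q θ) / z₁ (q θ)‖ = R := by
        rw [e1, e2, norm_div, norm_mul, hs]
        have : ‖c‖ ≠ 0 := norm_ne_zero_iff.2 hc
        field_simp
      have h1 := Complex.abs_re_le_norm (z₂ (q θ) / z₁ (q θ))
      have h2 := Complex.abs_im_le_norm (z₂ (q θ) / z₁ (q θ))
      rw [hn] at h1 h2
      exact ⟨abs_le.1 h1, abs_le.1 h2⟩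
  have hqc : Continuous q := by fun_prop
  have hLq : Continuous fun θ => L (q θ) := hL.comp_continuous hqc hq
  have hR0' : (R : ℂ) ≠ 0 := by exact_mod_cast hR0.ne'
  have h := eq_of_exp_eq_one (isPreconnected_univ (α := ℝ))
    (k := fun θ => L (q θ) + θ * Complex.I - Complex.log (c * (R : ℂ)⁻¹))
    (Continuous.continuousOn ((hLq.add
      (Complex.continuous_ofReal.mul continuous_const)).sub continuous_const))
    (fun θ _ => by
      rw [Complex.exp_sub, Complex.exp_add, hL1 _ (hq θ), e1,
        Complex.exp_log (mul_ne_zero hc (inv_ne_zero hR0')),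
        div_eq_one_iff_eq (mul_ne_zero hc (inv_ne_zero hR0'))]
      simp only [s]
      rw [mul_assoc, mul_assoc, ← Complex.exp_add]
      simp)
    (mem_univ (2 * Real.pi)) (mem_univ 0)
  have hper : q (2 * Real.pi) = q 0 := by
    have : s (2 * Real.pi) = s 0 := by
      simp only [s]
      push_cast
      rw [Complex.exp_neg, Complex.exp_two_pi_mul_I]
      simp
    simp only [q, this]
  rw [hper] at h
  have h2 : ((2 * Real.pi : ℝ) : ℂ) * Complex.I = 0 := by
    push_cast at h ⊢
    linear_combination h
  rw [mul_eq_zero] at h2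
  rcases h2 with h2 | h2
  · have : 2 * Real.pi = 0 := by exact_mod_cast h2
    linarith [Real.pi_pos]
  · exact Complex.I_ne_zero h2

theorem exists_functional {V : Submodule ℂ (Cn n)} {x : Cn n} (hx : x ∉ V) :
    ∃ f : Cn n →L[ℂ] ℂ, f x = 1 ∧ ∀ v ∈ V, f v = 0 := by
  obtain ⟨f, hf, hfV⟩ := Submodule.exists_le_ker_of_notMem hx
  refine ⟨LinearMap.toContinuousLinearMap ((f x)⁻¹ • f), ?_, fun v hv => ?_⟩
  · simp [inv_mul_cancel₀ hf]
  · have : f v = 0 := hfV hv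
    simp [this]

/-- A maximal subspace `W` missing `D` is a hyperplane. By maximality, every vector outside `W` has
a nonzero multiple which some element of `W` carries into `D`. With two independent vectors modulo
`W` this would contradict `not_forall_slope_hit`. -/
theorem exists_functional_ne_zero (hD : IsCConvexDomainWithoutLines D) (h0 : (0 : Cn n) ∉ D) :
    ∃ f : Cn n →L[ℂ] ℂ, ∀ w ∈ D, f w ≠ 0 := by
  obtain ⟨W, hDW, hmax⟩ := WellFounded.has_min (wellFounded_gt (α := Submodule ℂ (Cn n)))
    {W : Submodule ℂ (Cn n) | ∀ w ∈ W, w ∉ D} ⟨⊥, by rintro w hw; rwa [(Submodule.mem_bot ℂ).1 hw]⟩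
  have hgt : ∀ u ∉ W, ∃ w ∈ W, ∃ c : ℂ, c ≠ 0 ∧ w + c • u ∈ D := by
    intro u hu
    have hlt : W < W ⊔ Submodule.span ℂ {u} := by
      refine lt_of_le_of_ne le_sup_left fun h => hu ?_
      rw [h]
      exact Submodule.mem_sup_right (Submodule.mem_span_singleton_self u)
    have h1 : ¬ ∀ w ∈ W ⊔ Submodule.span ℂ {u}, w ∉ D := fun h => hmax _ h hlt
    push Not at h1
    obtain ⟨p, hp, hpD⟩ := h1
    obtain ⟨w, hw, y, hy, rfl⟩ := Submodule.mem_sup.1 hp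
    obtain ⟨c, rfl⟩ := Submodule.mem_span_singleton.1 hy
    refine ⟨w, hw, c, ?_, hpD⟩
    rintro rfl
    exact hDW w hw (by simpa using hpD)
  obtain ⟨u₁, hu₁D⟩ := hD.isConnected.nonempty
  have hu₁ : u₁ ∉ W := fun h => hDW u₁ h hu₁D
  by_cases htop : W ⊔ Submodule.span ℂ {u₁} = ⊤
  · obtain ⟨f, hf1, hfW⟩ := exists_functional hu₁
    refine ⟨f, fun p hp hfp => ?_⟩
    obtain ⟨w, hw, y, hy, rfl⟩ := Submodule.mem_sup.1 (htop ▸ Submodule.mem_top : p ∈ _)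
    obtain ⟨c, rfl⟩ := Submodule.mem_span_singleton.1 hy
    have : c = 0 := by simpa [hfW w hw, hf1] using hfp
    subst this
    exact hDW w hw (by simpa using hp)
  · obtain ⟨u₂, -, hu₂⟩ := SetLike.exists_of_lt (lt_top_iff_ne_top.2 htop)
    have hu₂' : u₂ ∉ W := fun h => hu₂ (Submodule.mem_sup_left h)
    have hu₁' : u₁ ∉ W ⊔ Submodule.span ℂ {u₂} := by
      intro h
      obtain ⟨w, hw, y, hy, he⟩ := Submodule.mem_sup.1 h
      obtain ⟨c, rfl⟩ := Submodule.mem_span_singleton.1 hy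
      by_cases hc : c = 0
      · subst hc
        exact hu₁ (by simpa [← he] using hw)
      · refine hu₂ (Submodule.mem_sup.2 ⟨-(c⁻¹ • w), W.neg_mem (W.smul_mem _ hw), c⁻¹ • u₁,
          Submodule.smul_mem _ _ (Submodule.mem_span_singleton_self _), ?_⟩)
        rw [← he, smul_add, smul_smul, inv_mul_cancel₀ hc]
        module
    obtain ⟨f₁, h11, h1W⟩ := exists_functional hu₁'
    obtain ⟨f₂, h22, h2W⟩ := exists_functional hu₂
    have hz : IsDualPair W u₁ u₂ f₁ f₂ :=
      ⟨fun w hw => h1W w (Submodule.mem_sup_left hw), fun w hw => h2W w (Submodule.mem_sup_left hw),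
        h11, h1W _ (Submodule.mem_sup_right (Submodule.mem_span_singleton_self _)),
        h2W _ (Submodule.mem_sup_right (Submodule.mem_span_singleton_self _)), h22⟩
    refine absurd (fun α β hαβ => hgt _ fun hmem => ?_) (not_forall_slope_hit hD hDW hz)
    have e1 : f₁ (α • u₁ + β • u₂) = α := by simp [hz.fst_fst, hz.fst_snd]
    have e2 : f₂ (α • u₁ + β • u₂) = β := by simp [hz.snd_fst, hz.snd_snd]
    rw [hz.fst_zero _ hmem] at e1
    rw [hz.snd_zero _ hmem] at e2
    rcases hαβ with h | h
    exacts [h e1.symm, h e2.symm]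

theorem IsCConvexDomainWithoutLines.translate (hD : IsCConvexDomainWithoutLines D) (p : Cn n) :
    IsCConvexDomainWithoutLines ((fun x => p + x) ⁻¹' D) where
  isOpen := hD.isOpen.preimage (by fun_prop)
  isConnected := by
    have : (fun x => p + x) ⁻¹' D = (fun x => -p + x) '' D := by
      ext x
      refine ⟨fun h => ⟨p + x, h, by simp⟩, ?_⟩
      rintro ⟨y, hy, rfl⟩
      simpa using hy
    rw [this]
    exact hD.isConnected.image _ (by fun_prop)
  slice := by
    intro q v hv
    have := hD.slice (p + q) v hv
    simpa only [mem_preimage, add_assoc] using this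

/-- **Linear convexity** of `ℂ`-convex domains: through each point outside `D` there passes a
complex hyperplane which does not meet `D`. -/
theorem IsCConvexDomainWithoutLines.exists_functional (hD : IsCConvexDomainWithoutLines D)
    {z x : Cn n} (hz : z ∈ D) (hx : z + x ∉ D) :
    ∃ f : Cn n →L[ℂ] ℂ, (∀ w ∈ D, f (w - z) ≠ 1) ∧ f x = 1 := by
  obtain ⟨f, hf⟩ := exists_functional_ne_zero (hD.translate (z + x)) (by simpa using hx)
  have hfx : f x ≠ 0 := by
    have := hf (-x) (by simpa using hz)
    simpa using this
  refine ⟨(f x)⁻¹ • f, fun w hw h => ?_, by simp [hfx]⟩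
  have h1 := hf (w - z - x) (by simpa [sub_sub] using hw)
  refine h1 ?_
  have h2 : (f x)⁻¹ * f (w - z) = 1 := by simpa using h
  rw [map_sub f (w - z) x]
  field_simp at h2
  rw [h2, sub_self]

end LinearConvexity
-- Support function and coordinate estimates for the bases
section Bases

variable {n : ℕ} {D : Set (Cn n)} {z : Cn n}

/-- The linear functional `f` defines the complex hyperplane `{f (w - z) = 1}`, which does not
meet `D`. -/
def OmitsOne (D : Set (Cn n)) (z : Cn n) (f : Cn n →L[ℂ] ℂ) : Prop :=
  ∀ w ∈ D, f (w - z) ≠ 1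

theorem OmitsOne.norm_apply_le {f : Cn n →L[ℂ] ℂ} (hf : OmitsOne D z f) {X : Cn n} {r : ℝ}
    (hr : 0 < r) (hX : ∀ ζ : ℂ, ‖ζ‖ < r → z + ζ • X ∈ D) : ‖f X‖ ≤ r⁻¹ := by
  by_contra! h
  have h0 : f X ≠ 0 := norm_pos_iff.1 ((inv_pos.2 hr).trans h)
  refine hf _ (hX (f X)⁻¹ ?_) (by simp [h0])
  rw [norm_inv]
  exact inv_lt_of_inv_lt₀ hr h

theorem OmitsOne.enorm_apply_le {f : Cn n →L[ℂ] ℂ} (hf : OmitsOne D z f) (X : Cn n) :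
    ‖f X‖ₑ ≤ (dirDist D z X)⁻¹ := by
  rw [ENNReal.le_inv_iff_le_inv, dirDist]
  refine iSup₂_le fun r hr => ?_
  rcases eq_or_ne r 0 with rfl | hr0
  · simp
  have h := hf.norm_apply_le (NNReal.coe_pos.2 (pos_iff_ne_zero.2 hr0)) hr
  rw [ENNReal.le_inv_iff_le_inv, ← ENNReal.coe_inv hr0, enorm_eq_nnnorm]
  exact_mod_cast h

theorem exists_notMem_of_dirDist_lt {X : Cn n} {r : ℝ≥0} (h : dirDist D z X < r) :
    ∃ ζ : ℂ, ‖ζ‖ < r ∧ z + ζ • X ∉ D := by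
  by_contra! hc
  exact h.not_ge (le_iSup₂_of_le r hc le_rfl)

/-- The reciprocal boundary distance is the support function of the hyperplanes missing `D`. -/
theorem inv_dirDist_le (hD : IsCConvexDomainWithoutLines D) (hz : z ∈ D) {X : Cn n} {a : ℝ≥0∞}
    (ha : ∀ f, OmitsOne D z f → ‖f X‖ₑ ≤ a) : (dirDist D z X)⁻¹ ≤ a := by
  rw [ENNReal.inv_le_iff_inv_le]
  by_contra! h
  obtain ⟨r, hr1, hr2⟩ := ENNReal.lt_iff_exists_nnreal_btwn.1 h
  obtain ⟨ζ, hζ, hζD⟩ := exists_notMem_of_dirDist_lt hr1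
  obtain ⟨f, hf, hf1⟩ := hD.exists_functional hz hζD
  have h1 := ha f hf
  rw [map_smul, smul_eq_mul] at hf1
  have hr0 : r ≠ 0 := by
    rintro rfl
    simp only [NNReal.coe_zero] at hζ
    exact absurd hζ (norm_nonneg ζ).not_gt
  have h2 : ‖ζ‖₊ * ‖f X‖₊ = 1 := by rw [← nnnorm_mul, hf1, nnnorm_one]
  have h3 : r⁻¹ ≤ ‖f X‖₊ := by
    have h4 : ‖ζ‖₊ < r := hζ
    rw [inv_le_iff_one_le_mul₀ (pos_iff_ne_zero.2 hr0), mul_comm, ← h2]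
    gcongr
  have h5 : (r : ℝ≥0∞)⁻¹ ≤ a := by
    rw [← ENNReal.coe_inv hr0]
    refine le_trans ?_ h1
    rw [enorm_eq_nnnorm]
    exact_mod_cast h3
  rw [ENNReal.inv_le_iff_inv_le] at h5
  exact h5.not_gt hr2

theorem exists_mem_frontier {Y : Type*} [TopologicalSpace Y] {S : Set Y} {φ : ℝ → Y}
    (hφ : ContinuousOn φ (Icc 0 1)) (h0 : φ 0 ∈ S) (h1 : φ 1 ∉ S) :
    ∃ t ∈ Icc (0 : ℝ) 1, φ t ∈ frontier S := by
  by_contra! h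
  have hpre : IsPreconnected (φ '' Icc 0 1) := isPreconnected_Icc.image φ hφ
  obtain ⟨y, -, hy, hy'⟩ := hpre (interior S) (closure S)ᶜ isOpen_interior
    isClosed_closure.isOpen_compl (by
      rintro _ ⟨t, ht, rfl⟩
      by_contra hc
      rw [mem_union, not_or, notMem_compl_iff] at hc
      exact h t ht ⟨hc.2, hc.1⟩)
    ⟨φ 0, mem_image_of_mem φ (by simp), by
      by_contra hc
      exact h 0 (by simp) ⟨subset_closure h0, hc⟩⟩
    ⟨φ 1, mem_image_of_mem φ (by simp), fun hc =>
      h 1 (by simp) ⟨hc, fun hi => h1 (interior_subset hi)⟩⟩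
  exact hy' (interior_subset_closure hy)

theorem mem_of_norm_lt_infEDist {r : ℝ≥0} (hz : z ∈ D) (hr : infEDist z (frontier D) = r)
    {Y : Cn n} (hY : ‖Y‖ < r) : z + Y ∈ D := by
  by_contra hc
  obtain ⟨t, ht, hf⟩ := exists_mem_frontier (S := D) (φ := fun t : ℝ => z + t • Y) (by fun_prop)
    (by simpa using hz) (by simpa using hc)
  have h1 := infEDist_le_edist_of_mem (x := z) hf
  rw [hr, edist_comm, edist_eq_enorm_sub, add_sub_cancel_left, enorm_eq_nnnorm] at h1
  have h2 : (r : ℝ) ≤ ‖t • Y‖ := by exact_mod_cast h1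
  rw [norm_smul, Real.norm_of_nonneg ht.1] at h2
  nlinarith [ht.2, norm_nonneg Y]

theorem mem_of_norm_lt_infEDist_relFrontier {r : ℝ≥0} (hz : z ∈ D) {b : Fin n → Cn n} {k : Fin n}
    (hr : infEDist z (relFrontier (orthPlane z b k) D) = r) {Y : Cn n}
    (hYb : ∀ j < k, inner ℂ (b j) Y = 0) (hY : ‖Y‖ < r) : z + Y ∈ D := by
  by_contra hc
  have hmem : ∀ t : ℝ, z + t • Y ∈ orthPlane z b k := by
    intro t j hj
    rw [add_sub_cancel_left, ← Complex.coe_smul, inner_smul_right, hYb j hj, mul_zero]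
  obtain ⟨t, ht, hf⟩ := exists_mem_frontier (S := (Subtype.val ⁻¹' D : Set (orthPlane z b k)))
    (φ := fun t : ℝ => ⟨z + t • Y, hmem t⟩) (by fun_prop)
    (by simpa using hz) (by simpa using hc)
  have h1 := infEDist_le_edist_of_mem (x := z) (mem_image_of_mem Subtype.val hf)
  change infEDist z (relFrontier (orthPlane z b k) D) ≤ _ at h1
  dsimp only at h1
  rw [hr, edist_comm, edist_eq_enorm_sub, add_sub_cancel_left, enorm_eq_nnnorm] at h1
  have h2 : (r : ℝ) ≤ ‖t • Y‖ := by exact_mod_cast h1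
  rw [norm_smul, Real.norm_of_nonneg ht.1] at h2
  nlinarith [ht.2, norm_nonneg Y]

/-- A functional which attains its bound `‖Y‖ / r` at a unit vector `e` of a subspace vanishes on
the orthogonal complement of `e` in the subspace. -/
theorem apply_eq_zero_of_norm_le {V : Submodule ℂ (Cn n)} {f : Cn n →L[ℂ] ℂ} {e : Cn n} {r : ℝ}
    (hr : 0 < r) (he : ‖e‖ = 1) (heV : e ∈ V) (hfe : f e = (r : ℂ)⁻¹)
    (hf : ∀ Y ∈ V, ‖f Y‖ ≤ ‖Y‖ / r) {Y : Cn n} (hY : Y ∈ V) (heY : inner ℂ e Y = 0) :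
    f Y = 0 := by
  by_contra hne
  set Z : Cn n := (f Y)⁻¹ • Y with hZ
  have hfZ : f Z = 1 := by simp [hZ, hne]
  -- Adding `ε • Z` to `e` raises the value of `f` to first order in `ε` and the norm only to second
  -- order. This choice of `ε` is small enough to violate the bound.
  set ε : ℝ := r / (‖Z‖ ^ 2 + 1) with hε
  have hε0 : 0 < ε := by positivity
  have h1 := hf (e + (ε : ℂ) • Z)
    (V.add_mem heV (V.smul_mem _ (V.smul_mem _ hY)))
  have h2 : f (e + (ε : ℂ) • Z) = ((r⁻¹ + ε : ℝ) : ℂ) := by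
    rw [map_add, map_smul, hfe, hfZ]
    push_cast
    simp
  have h3 : ‖e + (ε : ℂ) • Z‖ ^ 2 = 1 + ε ^ 2 * ‖Z‖ ^ 2 := by
    have horth : inner ℂ e ((ε : ℂ) • Z) = 0 := by
      rw [inner_smul_right, hZ, inner_smul_right, heY, mul_zero, mul_zero]
    have := norm_add_sq_eq_norm_sq_add_norm_sq_of_inner_eq_zero e ((ε : ℂ) • Z) horth
    rw [sq, this, he, norm_smul, Complex.norm_real, Real.norm_of_nonneg hε0.le]
    ring
  rw [h2, Complex.norm_real, Real.norm_of_nonneg (by positivity), le_div_iff₀ hr] at h1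
  have h4 : (1 + ε * r) ^ 2 ≤ 1 + ε ^ 2 * ‖Z‖ ^ 2 := by
    rw [← h3]
    have : (r⁻¹ + ε) * r = 1 + ε * r := by field_simp
    rw [this] at h1
    gcongr
  have h5 : ε * ‖Z‖ ^ 2 ≤ r := by
    rw [hε, div_mul_eq_mul_div, div_le_iff₀ (by positivity)]
    nlinarith [hr.le]
  nlinarith [mul_pos hε0 hr, sq_nonneg (ε * r), mul_le_mul_of_nonneg_left h5 hε0.le]

variable {b : OrthonormalBasis (Fin n) ℂ (Cn n)} {r : Fin n → ℝ≥0}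

/-- The coordinate estimate in a direction pointing to a nearest boundary point. -/
theorem norm_inner_div_le_of_nearest (hD : IsCConvexDomainWithoutLines D) (hz : z ∈ D)
    {k : Fin n} (hrk : 0 < r k) (hnot : z + (r k : ℝ) • b k ∉ D)
    (hball : ∀ Y, (∀ j < k, inner ℂ (b j) Y = 0) → ‖Y‖ < r k → z + Y ∈ D)
    {Y : Cn n} (hY : ∀ j < k, inner ℂ (b j) Y = 0) {t : ℝ}
    (ht : ∀ f, OmitsOne D z f → ‖f Y‖ ≤ t) : ‖(inner ℂ (b k) Y : ℂ)‖ / r k ≤ t := by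
  obtain ⟨f, hf, hf1⟩ := hD.exists_functional hz hnot
  have hr0 : (0 : ℝ) < r k := hrk
  have hfb : f (b k) = ((r k : ℝ) : ℂ)⁻¹ := by
    rw [← Complex.coe_smul, map_smul, smul_eq_mul] at hf1
    exact eq_inv_of_mul_eq_one_right hf1
  let V : Submodule ℂ (Cn n) :=
    { carrier := {Y | ∀ j < k, inner ℂ (b j) Y = 0}
      add_mem' := fun {p q} hp hq j hj => by rw [inner_add_right, hp j hj, hq j hj, add_zero]
      zero_mem' := fun j _ => inner_zero_right _
      smul_mem' := fun c p hp j hj => by rw [inner_smul_right, hp j hj, mul_zero] }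
  have hVf : ∀ Y ∈ V, ‖f Y‖ ≤ ‖Y‖ / r k := by
    intro Y hYV
    rcases eq_or_ne Y 0 with rfl | hY0
    · simp
    have hn : 0 < ‖Y‖ := norm_pos_iff.2 hY0
    rw [← inv_div]
    refine OmitsOne.norm_apply_le (D := D) hf (by positivity) fun ζ hζ =>
      hball _ (V.smul_mem ζ hYV) ?_
    rwa [norm_smul, ← lt_div_iff₀ hn]
  have hbV : b k ∈ V := fun j hj => by
    rw [orthonormal_iff_ite.1 b.orthonormal, if_neg hj.ne]
  -- On `V` the supporting functional attains its bound at `b k`, so there it equals `⟨b k, ·⟩ / r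
  -- k`.
  have hdec : f Y = inner ℂ (b k) Y * ((r k : ℝ) : ℂ)⁻¹ := by
    have h0 : f (Y - inner ℂ (b k) Y • b k) = 0 := by
      refine apply_eq_zero_of_norm_le hr0 (b.orthonormal.1 k) hbV hfb hVf
        (V.sub_mem hY (V.smul_mem _ hbV)) ?_
      rw [inner_sub_right, inner_smul_right, inner_self_eq_norm_sq_to_K, b.orthonormal.1 k]
      simp
    rw [map_sub, map_smul, hfb, smul_eq_mul] at h0
    exact sub_eq_zero.1 h0
  have := ht f hf
  rwa [hdec, norm_mul, norm_inv, Complex.norm_real, Real.norm_of_nonneg hr0.le,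
    ← div_eq_mul_inv] at this

/-- Coordinate estimates in the successive orthogonal complements give coordinate estimates. -/
theorem norm_inner_div_le (hb : ∀ f, OmitsOne D z f → ∀ k, ‖f (b k)‖ ≤ (r k : ℝ)⁻¹)
    (hstep : ∀ k Y, (∀ j < k, inner ℂ (b j) Y = 0) → ∀ t : ℝ,
      (∀ f, OmitsOne D z f → ‖f Y‖ ≤ t) → ‖(inner ℂ (b k) Y : ℂ)‖ / r k ≤ t)
    {X : Cn n} {t : ℝ} (ht : ∀ f, OmitsOne D z f → ‖f X‖ ≤ t) (k : Fin n) :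
    ‖(inner ℂ (b k) X : ℂ)‖ / r k ≤ 2 ^ (k : ℕ) * t := by
  -- Subtract the first `i` components from `X`. Removing component `i` changes `f Y` by at most
  -- `|⟨b i, Y⟩| / r i`, itself at most the current bound by `hstep`, so each removal doubles the
  -- bound.
  have hmain : ∀ i : ℕ, ∃ Y : Cn n, (∀ j : Fin n, (j : ℕ) < i → inner ℂ (b j) Y = 0) ∧
      (∀ j : Fin n, i ≤ j → inner ℂ (b j) Y = inner ℂ (b j) X) ∧
      ∀ f, OmitsOne D z f → ‖f Y‖ ≤ 2 ^ i * t := by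
    intro i
    induction i with
    | zero => exact ⟨X, by simp, by simp, by simpa using ht⟩
    | succ i ih =>
      obtain ⟨Y, hY1, hY2, hY3⟩ := ih
      by_cases hi : i < n
      · have hs := hstep ⟨i, hi⟩ Y (fun j hj => hY1 j hj) _ hY3
        refine ⟨Y - (inner ℂ (b ⟨i, hi⟩) Y : ℂ) • b ⟨i, hi⟩, fun j hj => ?_, fun j hj => ?_,
          fun f hf => ?_⟩
        · rw [inner_sub_right, inner_smul_right, orthonormal_iff_ite.1 b.orthonormal]
          split_ifs with h
          · rw [h]; simp
          · have : (j : ℕ) < i := lt_of_le_of_ne (Nat.lt_succ_iff.1 hj) fun h' => h (Fin.ext h')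
            rw [hY1 j this]; simp
        · rw [inner_sub_right, inner_smul_right, orthonormal_iff_ite.1 b.orthonormal, if_neg,
            hY2 j (by omega)]
          · simp
          · rintro rfl
            simp at hj
        · rw [map_sub, map_smul, smul_eq_mul]
          refine (norm_sub_le _ _).trans ?_
          rw [norm_mul]
          have h1 := hY3 f hf
          have h2 := mul_le_mul_of_nonneg_left (hb f hf ⟨i, hi⟩)
            (norm_nonneg (inner ℂ (b ⟨i, hi⟩) Y : ℂ))
          rw [← div_eq_mul_inv] at h2
          rw [pow_succ]
          linarith
      · refine ⟨0, by simp, fun j hj => by omega, fun f hf => ?_⟩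
        have := (norm_nonneg _).trans (ht f hf)
        simp only [map_zero, norm_zero]
        positivity
  obtain ⟨Y, hY1, hY2, hY3⟩ := hmain k
  rw [← hY2 k le_rfl]
  exact hstep k Y (fun j hj => hY1 j hj) _ hY3

theorem IsMaximalBasis.notMem (h : IsMaximalBasis D z b r) (hD : IsOpen D) (k : Fin n) :
    z + (r k : ℝ) • b k ∉ D := fun hmem => by
  have := h.mem_frontier k
  rw [hD.frontier_eq] at this
  exact this.2 hmem

theorem IsMinimalBasis.notMem (h : IsMinimalBasis D z b r) (hD : IsOpen D) (k : Fin n) :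
    z + (r k : ℝ) • b k ∉ D := fun hmem => by
  obtain ⟨p, hp, hpe⟩ := h.mem_frontier k
  rw [(hD.preimage continuous_subtype_val).frontier_eq] at hp
  exact hp.2 (by rwa [mem_preimage, hpe])

theorem pos_of_notMem (hz : z ∈ D) {k : Fin n} (h : z + (r k : ℝ) • b k ∉ D) : 0 < r k := by
  rw [pos_iff_ne_zero]
  intro h0
  rw [h0] at h
  exact h (by simpa using hz)

theorem IsMaximalBasis.disc_subset (h : IsMaximalBasis D z b r) (hz : z ∈ D) (k : Fin n)
    {ζ : ℂ} (hζ : ‖ζ‖ < r k) : z + ζ • b k ∈ D := by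
  by_cases hk : (k : ℕ) = 0
  · refine mem_of_norm_lt_infEDist hz (h.first k hk) ?_
    rwa [norm_smul, b.orthonormal.1 k, mul_one]
  · have h1 : (‖ζ‖₊ : ℝ≥0∞) < dirDist D z (b k) := by
      rw [h.dirDist_eq k hk]
      exact_mod_cast hζ
    obtain ⟨ρ, hρ⟩ := lt_iSup_iff.1 h1
    obtain ⟨hρD, hρζ⟩ := lt_iSup_iff.1 hρ
    exact hρD ζ (by exact_mod_cast hρζ)

theorem IsMinimalBasis.disc_subset (h : IsMinimalBasis D z b r) (hz : z ∈ D) (k : Fin n)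
    {ζ : ℂ} (hζ : ‖ζ‖ < r k) : z + ζ • b k ∈ D := by
  refine mem_of_norm_lt_infEDist_relFrontier hz (h.dist_eq k) (fun j hj => ?_) ?_
  · rw [inner_smul_right, orthonormal_iff_ite.1 b.orthonormal, if_neg hj.ne, mul_zero]
  · rwa [norm_smul, b.orthonormal.1 k, mul_one]

/-- Index 0 is the nearest-point case. At later indices maximality bounds `d_D` by `r k` in the
direction of `Y`, so the support function there is at least `1 / r k`, and `|⟨b k, Y⟩| ≤ ‖Y‖`
finishes. -/
theorem IsMaximalBasis.norm_inner_div_le (h : IsMaximalBasis D z b r)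
    (hD : IsCConvexDomainWithoutLines D) (hz : z ∈ D) {X : Cn n} {t : ℝ}
    (ht : ∀ f, OmitsOne D z f → ‖f X‖ ≤ t) (k : Fin n) :
    ‖(inner ℂ (b k) X : ℂ)‖ / r k ≤ 2 ^ (k : ℕ) * t := by
  have hpos : ∀ k, 0 < r k := fun k => pos_of_notMem hz (h.notMem hD.isOpen k)
  refine ExtremalBasis.norm_inner_div_le
    (fun f hf k => hf.norm_apply_le (hpos k) fun ζ => h.disc_subset hz k) ?_ ht k
  intro k Y hY t ht
  by_cases hk : (k : ℕ) = 0
  · exact norm_inner_div_le_of_nearest hD hz (hpos k) (h.notMem hD.isOpen k)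
      (fun Y _ hYr => mem_of_norm_lt_infEDist hz (h.first k hk) hYr) hY ht
  · rcases eq_or_ne Y 0 with rfl | hY0
    · have := ht 0 fun w _ => by simp
      simpa using this
    have hn : 0 < ‖Y‖ := norm_pos_iff.2 hY0
    have ht0 : 0 ≤ t := (norm_nonneg _).trans (ht 0 fun w _ => by simp)
    set v : Cn n := ((‖Y‖ : ℂ)⁻¹) • Y with hv
    have hv1 : ‖v‖ = 1 := by
      rw [hv, norm_smul, norm_inv, Complex.norm_real, norm_norm, inv_mul_cancel₀ hn.ne']
    have h1 := h.maximal k hk v hv1 fun j hj => by rw [hv, inner_smul_right, hY j hj, mul_zero]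
    have h2 : (dirDist D z v)⁻¹ ≤ ENNReal.ofReal (t / ‖Y‖) := by
      refine inv_dirDist_le hD hz fun f hf => ?_
      rw [← ofReal_norm]
      refine ENNReal.ofReal_le_ofReal ?_
      rw [hv, map_smul, norm_smul, norm_inv, Complex.norm_real, norm_norm, inv_mul_eq_div]
      gcongr
      exact ht f hf
    have h3 : ((r k : ℝ))⁻¹ ≤ t / ‖Y‖ := by
      have h4 := (ENNReal.inv_le_inv.2 h1).trans h2
      rw [← ENNReal.coe_inv (hpos k).ne', ← ENNReal.ofReal_coe_nnreal,
        ENNReal.ofReal_le_ofReal_iff (by positivity)] at h4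
      simpa using h4
    have h5 : ‖(inner ℂ (b k) Y : ℂ)‖ ≤ ‖Y‖ := by
      simpa [b.orthonormal.1 k] using norm_inner_le_norm (𝕜 := ℂ) (b k) Y
    calc ‖(inner ℂ (b k) Y : ℂ)‖ / r k = ‖(inner ℂ (b k) Y : ℂ)‖ * (r k : ℝ)⁻¹ := div_eq_mul_inv _ _
      _ ≤ ‖Y‖ * (t / ‖Y‖) := by gcongr
      _ = t := by field_simp

theorem IsMinimalBasis.norm_inner_div_le (h : IsMinimalBasis D z b r)
    (hD : IsCConvexDomainWithoutLines D) (hz : z ∈ D) {X : Cn n} {t : ℝ}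
    (ht : ∀ f, OmitsOne D z f → ‖f X‖ ≤ t) (k : Fin n) :
    ‖(inner ℂ (b k) X : ℂ)‖ / r k ≤ 2 ^ (k : ℕ) * t := by
  have hpos : ∀ k, 0 < r k := fun k => pos_of_notMem hz (h.notMem hD.isOpen k)
  refine ExtremalBasis.norm_inner_div_le
    (fun f hf k => hf.norm_apply_le (hpos k) fun ζ => h.disc_subset hz k) ?_ ht k
  intro k Y hY t ht
  exact norm_inner_div_le_of_nearest hD hz (hpos k) (h.notMem hD.isOpen k)
    (fun Y hYb hYr => mem_of_norm_lt_infEDist_relFrontier hz (h.dist_eq k) hYb hYr) hY ht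

theorem coe_basisSum (b : OrthonormalBasis (Fin n) ℂ (Cn n)) (r : Fin n → ℝ≥0) (X : Cn n) :
    (basisSum b r X : ℝ) = ∑ j, ‖(inner ℂ (b j) X : ℂ)‖ / r j := by
  simp [basisSum]

theorem basisSum_le_of_norm_inner_div_le {X : Cn n} {t : ℝ} (ht : 0 ≤ t)
    (h : ∀ k : Fin n, ‖(inner ℂ (b k) X : ℂ)‖ / r k ≤ 2 ^ (k : ℕ) * t) :
    (basisSum b r X : ℝ) ≤ 2 ^ n * t := by
  rw [coe_basisSum]
  refine (Finset.sum_le_sum fun k _ => h k).trans ?_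
  rw [← Finset.sum_mul, Fin.sum_univ_eq_sum_range (fun i => (2 : ℝ) ^ i) n]
  gcongr
  rw [geom_sum_eq (by norm_num)]
  norm_num

theorem norm_apply_le_basisSum {f : Cn n →L[ℂ] ℂ} (hf : ∀ k, ‖f (b k)‖ ≤ (r k : ℝ)⁻¹)
    (X : Cn n) : ‖f X‖ ≤ basisSum b r X := by
  rw [coe_basisSum]
  conv_lhs => rw [← b.sum_repr' X, map_sum]
  refine (norm_sum_le _ _).trans (Finset.sum_le_sum fun k _ => ?_)
  rw [map_smul, norm_smul, div_eq_mul_inv]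
  gcongr
  exact hf k

end Bases
-- The square root of a supporting function
section Root

variable {n : ℕ} {D : Set (Cn n)} {z : Cn n} {f : Cn n →L[ℂ] ℂ}

/-- After scaling up, the image of `D` under `f` contains the unit disc and still omits `1`. -/
theorem OmitsOne.exists_smul (hf : OmitsOne D z f) (hD : IsOpen D) (hz : z ∈ D) (hf0 : f ≠ 0) :
    ∃ c : ℂ, 1 ≤ ‖c‖ ∧ OmitsOne D z (c • f) ∧
      ∀ μ : ℂ, ‖μ‖ < 1 → ∃ w ∈ D, (c • f) (w - z) = μ := by
  set G : Set ℂ := (fun w => f (w - z)) '' D with hG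
  have hsurj : Function.Surjective f := by
    have : (f : Cn n →ₗ[ℂ] ℂ) ≠ 0 := fun h => hf0 (by ext x; exact congrArg (fun g => g x) h)
    exact LinearMap.surjective this
  have hGo : IsOpen G := by
    have h1 : IsOpenMap f := f.isOpenMap hsurj
    have h2 : G = f '' ((fun w => w - z) '' D) := by rw [hG, image_image]
    rw [h2]
    exact h1 _ ((Homeomorph.subRight z).isOpenMap _ hD)
  have h1G : (1 : ℂ) ∈ Gᶜ := by
    rintro ⟨w, hw, h⟩
    exact hf w hw h
  have h0G : (0 : ℂ) ∈ G := ⟨z, hz, by simp⟩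
  -- `b` is an omitted value of least modulus and the scaling factor is `b⁻¹`. Since 1 is omitted as
  -- well, `‖b‖ ≤ 1`.
  obtain ⟨b, hbG, hb⟩ := hGo.isClosed_compl.exists_infDist_eq_dist ⟨1, h1G⟩ (0 : ℂ)
  have hb0 : b ≠ 0 := by
    rintro rfl
    exact hbG h0G
  have hmin : ∀ μ ∈ Gᶜ, ‖b‖ ≤ ‖μ‖ := by
    intro μ hμ
    have := infDist_le_dist_of_mem (x := (0 : ℂ)) hμ
    rw [hb] at this
    simpa using this
  refine ⟨b⁻¹, ?_, ?_, ?_⟩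
  · rw [norm_inv]
    exact (one_le_inv₀ (norm_pos_iff.2 hb0)).2 (by simpa using hmin 1 h1G)
  · intro w hw h
    have : f (w - z) = b := by
      have h' : b⁻¹ * f (w - z) = 1 := h
      field_simp at h'
      exact h'
    exact hbG ⟨w, hw, this⟩
  · intro μ hμ
    have hbμ : b * μ ∈ G := by
      by_contra hc
      have := hmin _ hc
      rw [norm_mul] at this
      nlinarith [norm_pos_iff.2 hb0]
    obtain ⟨w, hw, h⟩ := hbμ
    refine ⟨w, hw, ?_⟩
    change b⁻¹ * f (w - z) = μ
    dsimp only at h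
    rw [h, inv_mul_cancel_left₀ hb0]

/-- Near `x` the continuous branch differs from a principal logarithm by a continuous function with
values in the discrete kernel of `exp`, which is locally constant. -/
theorem differentiableAt_of_exp_eq {E : Type*} [NormedAddCommGroup E] [NormedSpace ℂ E]
    {L F : E → ℂ} {x : E} (hL : ContinuousAt L x) (hF : DifferentiableAt ℂ F x)
    (h : ∀ᶠ y in 𝓝 x, Complex.exp (L y) = F y) : DifferentiableAt ℂ L x := by
  have hx : Complex.exp (L x) = F x := h.self_of_nhds
  have hx0 : F x ≠ 0 := hx ▸ Complex.exp_ne_zero _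
  have hlog : DifferentiableAt ℂ (fun y => Complex.log (F y / F x)) x := by
    refine DifferentiableAt.clog (by fun_prop (disch := assumption)) ?_
    rw [div_self hx0]
    exact Complex.one_mem_slitPlane
  have hk : Tendsto (fun y => L y - L x - Complex.log (F y / F x)) (𝓝 x)
      (𝓝[{w | Complex.exp w = 1}] 0) := by
    refine tendsto_nhdsWithin_iff.2 ⟨?_, ?_⟩
    · have : ContinuousAt (fun y => L y - L x - Complex.log (F y / F x)) x :=
        (hL.sub continuousAt_const).sub hlog.continuousAt
      have h0 := this.tendsto
      simpa [div_self hx0] using h0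
    · filter_upwards [h] with y hy
      have hy0 : F y ≠ 0 := hy ▸ Complex.exp_ne_zero _
      change Complex.exp _ = 1
      rw [Complex.exp_sub, Complex.exp_sub, hy, hx, Complex.exp_log (div_ne_zero hy0 hx0)]
      exact div_self (div_ne_zero hy0 hx0)
  rw [isDiscrete_iff_nhdsWithin.1 isDiscrete_exp_eq_one 0 Complex.exp_zero, tendsto_pure] at hk
  refine ((hlog.const_add (L x))).congr_of_eventuallyEq ?_
  filter_upwards [hk] with y hy
  linear_combination hy

/-- The logarithm is continued from `z` along the complex line to each `w ∈ D`. -/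
theorem exists_log_one_sub (hD : IsCConvexDomainWithoutLines D) (hz : z ∈ D)
    (hf : OmitsOne D z f) : ∃ L : Cn n → ℂ, DifferentiableOn ℂ L D ∧ L z = 0 ∧
      ∀ w ∈ D, Complex.exp (L w) = 1 - f (w - z) := by
  classical
  obtain ⟨L, hL, hL1, hL0⟩ := hD.exists_continuous_log (Y := D) (b := fun _ => z)
    (v := fun w => w - z) (β := fun w => -f (w - z)) (by fun_prop) (by fun_prop) (by fun_prop)
    (fun _ => hz) (fun w => by simp) (by
      intro w ζ hζ h0
      refine hf _ hζ ?_
      rw [add_sub_cancel_left, map_smul, smul_eq_mul]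
      linear_combination -h0)
  set Lx : Cn n → ℂ := fun w => if h : w ∈ D then L ⟨w, h⟩ else 0
  have hx : ∀ w (h : w ∈ D), Lx w = L ⟨w, h⟩ := fun w h => dif_pos h
  have hexp : ∀ w ∈ D, Complex.exp (Lx w) = 1 - f (w - z) := by
    intro w hw
    rw [hx w hw, hL1]
    ring
  have hc : ContinuousOn Lx D := by
    rw [continuousOn_iff_continuous_domRestrict]
    convert hL using 1
    ext w
    simp [Lx]
  refine ⟨Lx, fun w hw => ?_, ?_, hexp⟩
  · refine (differentiableAt_of_exp_eq (hc.continuousAt (hD.isOpen.mem_nhds hw))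
      (F := fun w => 1 - f (w - z)) (by fun_prop) ?_).differentiableWithinAt
    filter_upwards [hD.isOpen.mem_nhds hw] with y hy using hexp y hy
  · rw [hx z hz]
    exact hL0 _ (sub_self z)

/-- The part of `D` where `|f| < 1` fibres over the unit disc with preconnected fibres, the traces
of `D` on parallel hyperplanes. `hfull` makes every fibre nonempty, which supplies the local
sections. The two branches agree at `z`, hence throughout this part. -/
theorem log_one_sub_eq (hD : IsCConvexDomainWithoutLines D) (hz : z ∈ D)
    (hfull : ∀ μ : ℂ, ‖μ‖ < 1 → ∃ w ∈ D, f (w - z) = μ) {L : Cn n → ℂ}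
    (hL : DifferentiableOn ℂ L D) (hLz : L z = 0)
    (hL1 : ∀ w ∈ D, Complex.exp (L w) = 1 - f (w - z)) {w : Cn n} (hw : w ∈ D)
    (hw1 : ‖f (w - z)‖ < 1) : L w = Complex.log (1 - f (w - z)) := by
  have hslit : ∀ w, ‖f (w - z)‖ < 1 → 1 - f (w - z) ∈ Complex.slitPlane := fun w hw =>
    Complex.ball_one_subset_slitPlane (by simpa using hw)
  have h := eq_of_exp_eq_one_of_fibers (A := {w | w ∈ D ∧ ‖f (w - z)‖ < 1}) (K := ball (0 : ℂ) 1)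
    (f := fun w => f (w - z)) (convex_ball _ _).isPreconnected
    (fun w hw => by simpa using hw.2) ?_ ?_
    (k := fun w => L w - Complex.log (1 - f (w - z))) ?_ ?_ (x := w) (x' := z) ⟨hw, hw1⟩
    ⟨hz, by simp⟩
  · simp only [sub_self, map_zero, sub_zero, Complex.log_one, hLz] at h
    exact sub_eq_zero.1 h
  · intro y hy
    have heq : {w | w ∈ D ∧ ‖f (w - z)‖ < 1} ∩ (fun w => f (w - z)) ⁻¹' {y} =
        D ∩ {w | f (w - z) = y} := by
      ext w
      constructor
      · rintro ⟨⟨h1, -⟩, h2⟩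
        exact ⟨h1, h2⟩
      · rintro ⟨h1, h2⟩
        have h2' : f (w - z) = y := h2
        exact ⟨⟨h1, by simpa [h2'] using hy⟩, h2⟩
    rw [heq]
    refine hD.isPreconnected_inter fun p hp q hq ζ => ?_
    have hp' : f (p - z) = y := hp
    have hq' : f (q - z) = y := hq
    change f (p + ζ • (q - p) - z) = y
    have : p + ζ • (q - p) - z = (p - z) + ζ • ((q - z) - (p - z)) := by module
    rw [this, map_add, map_smul, map_sub f (q - z), hp', hq']
    simp
  · intro y hy
    obtain ⟨w₀, hw₀, hw₀y⟩ := hfull y (by simpa using hy)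
    obtain ⟨v, -, hv⟩ := hfull (1 / 2) (by norm_num)
    have hσ : Continuous fun y' : ℂ => w₀ + (y' - y) • (2 : ℂ) • (v - z) := by fun_prop
    refine ⟨_, hσ.continuousAt, ?_⟩
    have h1 : ∀ᶠ y' in 𝓝[ball (0 : ℂ) 1] y, w₀ + (y' - y) • (2 : ℂ) • (v - z) ∈ D :=
      (hσ.continuousAt.mono_left nhdsWithin_le_nhds).eventually
        (hD.isOpen.mem_nhds (by simpa using hw₀))
    filter_upwards [h1, self_mem_nhdsWithin] with y' h1 h2
    have h3 : f (w₀ + (y' - y) • (2 : ℂ) • (v - z) - z) = y' := by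
      rw [add_sub_right_comm, map_add, map_smul, map_smul, hv, hw₀y, smul_eq_mul, smul_eq_mul]
      ring
    exact ⟨⟨h1, by rw [h3]; simpa using h2⟩, h3⟩
  · refine (hL.continuousOn.mono fun w hw => hw.1).sub ?_
    exact ContinuousOn.clog (by fun_prop) fun w hw => hslit w hw.2
  · rintro w ⟨hw, hw1⟩
    have h0 : 1 - f (w - z) ≠ 0 := Complex.slitPlane_ne_zero (hslit w hw1)
    rw [Complex.exp_sub, hL1 w hw, Complex.exp_log h0, div_self h0]

/-- The square root of a scaled supporting function: it stays away from `-1`. -/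
theorem exists_root (hD : IsCConvexDomainWithoutLines D) (hz : z ∈ D) (hf : OmitsOne D z f) :
    ∃ c : ℂ, 1 ≤ ‖c‖ ∧ ∃ h : Cn n → ℂ, DifferentiableOn ℂ h D ∧ h z = 1 ∧
      (∀ w ∈ D, h w ^ 2 = 1 - c * f (w - z)) ∧ ∀ w ∈ D, 1 / 3 ≤ ‖1 + h w‖ := by
  rcases eq_or_ne f 0 with rfl | hf0
  · refine ⟨1, by simp, fun _ => 1, differentiableOn_const _, rfl, by simp, fun w _ => ?_⟩
    norm_num
  obtain ⟨c, hc, hcf, hfull⟩ := hf.exists_smul hD.isOpen hz hf0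
  obtain ⟨L, hL, hLz, hL1⟩ := exists_log_one_sub hD hz hcf
  have hsq : ∀ w ∈ D, Complex.exp (L w / 2) ^ 2 = 1 - c * f (w - z) := by
    intro w hw
    rw [← Complex.exp_nat_mul]
    push_cast
    rw [mul_div_cancel₀ _ (two_ne_zero), hL1 w hw]
    rfl
  refine ⟨c, hc, fun w => Complex.exp (L w / 2), DifferentiableOn.cexp (by fun_prop),
    by simp [hLz], hsq,
    fun w hw => ?_⟩
  -- Where `|cf| < 1` the root is the principal one, with nonnegative real part, so `|1 + h| ≥ 1`.
  -- Elsewhere `|1 - h| |1 + h| = |cf| ≥ 1`, whereas `|1 + h| < 1 / 3` would make this product less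
  -- than `7 / 9`.
  by_cases h1 : ‖(c • f) (w - z)‖ < 1
  · have h2 := log_one_sub_eq hD hz hfull hL hLz hL1 hw h1
    have him : (L w / 2).im = Complex.arg (1 - (c • f) (w - z)) / 2 := by
      rw [h2, ← Complex.log_im]
      simp
    have hre : 0 ≤ (Complex.exp (L w / 2)).re := by
      rw [Complex.exp_re, him]
      refine mul_nonneg (Real.exp_pos _).le (Real.cos_nonneg_of_mem_Icc ⟨?_, ?_⟩)
      · have := Complex.neg_pi_lt_arg (1 - (c • f) (w - z))
        linarith
      · have := Complex.arg_le_pi (1 - (c • f) (w - z))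
        linarith
    have h3 := Complex.re_le_norm (1 + Complex.exp (L w / 2))
    rw [Complex.add_re, Complex.one_re] at h3
    dsimp only
    linarith
  · by_contra! hlt
    have h2 : (c • f) (w - z) = (1 - Complex.exp (L w / 2)) * (1 + Complex.exp (L w / 2)) := by
      have := hsq w hw
      change c * f (w - z) = _
      linear_combination this
    have h3 : ‖1 - Complex.exp (L w / 2)‖ ≤ 2 + ‖1 + Complex.exp (L w / 2)‖ := by
      have : 1 - Complex.exp (L w / 2) = 2 - (1 + Complex.exp (L w / 2)) := by ring
      rw [this]
      refine (norm_sub_le _ _).trans ?_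
      norm_num
    rw [h2, norm_mul] at h1
    nlinarith [norm_nonneg (1 + Complex.exp (L w / 2)), norm_nonneg (1 - Complex.exp (L w / 2))]

theorem fderiv_root (hD : IsOpen D) (hz : z ∈ D) {c : ℂ} {h : Cn n → ℂ}
    (hd : DifferentiableOn ℂ h D) (hz1 : h z = 1) (hsq : ∀ w ∈ D, h w ^ 2 = 1 - c * f (w - z))
    (X : Cn n) : fderiv ℂ h z X = -(c * f X) / 2 := by
  have h1 : HasFDerivAt h (fderiv ℂ h z) z :=
    ((hd z hz).differentiableAt (hD.mem_nhds hz)).hasFDerivAt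
  have h2 := h1.pow 2
  have h3 : HasFDerivAt (fun w => 1 - c * f (w - z)) (-(c • f)) z := by
    have h0 : HasFDerivAt (fun w => w - z) (ContinuousLinearMap.id ℂ (Cn n)) z :=
      (hasFDerivAt_id z).sub_const z
    have := ((HasFDerivAt.comp (g := f) (f := fun w => w - z) z f.hasFDerivAt h0).const_mul c).const_sub 1
    simpa using this
  have h4 : HasFDerivAt (fun w => h w ^ 2) (-(c • f)) z := by
    refine h3.congr_of_eventuallyEq ?_
    filter_upwards [hD.mem_nhds hz] with w hw using hsq w hw
  have h5 := congrArg (fun g => g X) (h2.unique h4)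
  simp [hz1] at h5
  linear_combination h5 / 2

/-- A bounded holomorphic function on `D`, vanishing at `z`, with large derivative. -/
theorem exists_bounded_function (hD : IsCConvexDomainWithoutLines D) (hz : z ∈ D)
    (hf : OmitsOne D z f) : ∃ g : Cn n → ℂ, DifferentiableOn ℂ g D ∧ g z = 0 ∧
      (∀ w ∈ D, ‖g w‖ ≤ 7) ∧ ∀ X, ‖f X‖ ≤ 4 * ‖fderiv ℂ g z X‖ := by
  obtain ⟨c, hc, h, hd, hz1, hsq, h3⟩ := exists_root hD hz hf
  have h0 : ∀ w ∈ D, 1 + h w ≠ 0 := fun w hw => norm_pos_iff.1 (by linarith [h3 w hw])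
  -- This is the Cayley transform `(1 - h) / (1 + h)`. The bound is `2 * 3 + 1 = 7`, and the
  -- derivative at `z` is `c f / 4`.
  refine ⟨fun w => (2 : ℂ) * (1 + h w)⁻¹ - 1, ?_, ?_, ?_, ?_⟩
  · exact ((DifferentiableOn.inv (hd.const_add 1) h0).const_mul 2).sub_const 1
  · simp only [hz1]; norm_num
  · intro w hw
    refine (norm_sub_le _ _).trans ?_
    rw [norm_mul, norm_inv]
    have := inv_anti₀ (by norm_num) (h3 w hw)
    norm_num at this ⊢
    linarith
  · intro X
    have h1 : HasFDerivAt h (fderiv ℂ h z) z :=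
      ((hd z hz).differentiableAt (hD.isOpen.mem_nhds hz)).hasFDerivAt
    have h2 := (((hasDerivAt_inv (h0 z hz)).comp_hasFDerivAt z (h1.const_add 1)).const_mul 2).sub_const 1
    have h4 : fderiv ℂ (fun w => (2 : ℂ) * (1 + h w)⁻¹ - 1) z X = c * f X / 4 := by
      have h2' : HasFDerivAt (fun w => (2 : ℂ) * (1 + h w)⁻¹ - 1) _ z := h2
      rw [h2'.fderiv]
      simp [fderiv_root hD.isOpen hz hd hz1 hsq, hz1]
      ring
    rw [h4, norm_div, norm_mul]
    norm_num
    nlinarith [norm_nonneg (f X)]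

end Root

/-! ### The Carathéodory and Kobayashi metrics -/

section Metrics

variable {n : ℕ} {D : Set (Cn n)} {z : Cn n}

theorem kobayashiMetric_le_inv_dirDist (X : Cn n) :
    kobayashiMetric D z X ≤ (dirDist D z X)⁻¹ := by
  rw [ENNReal.le_inv_iff_le_inv]
  refine iSup₂_le fun r hr => ?_
  rw [ENNReal.le_inv_iff_le_inv]
  rcases eq_or_ne r 0 with rfl | hr0
  · simp
  have hr0' : ((r : ℝ) : ℂ) ≠ 0 := by exact_mod_cast hr0
  have hder : HasDerivAt (fun ζ : ℂ => z + (ζ * ((r : ℝ) : ℂ)) • X) (((r : ℝ) : ℂ) • X) 0 := by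
    have := (((hasDerivAt_id (0 : ℂ)).mul_const ((r : ℝ) : ℂ)).smul_const X).const_add z
    simpa using this
  refine iInf_le_of_le ((r : ℝ) : ℂ)⁻¹ (iInf₂_le_of_le (fun ζ => z + (ζ * ((r : ℝ) : ℂ)) • X)
    ⟨by fun_prop, ?_, by simp, ?_⟩ ?_)
  · intro ζ hζ
    refine hr _ ?_
    rw [disc, mem_ball_zero_iff] at hζ
    have : (0 : ℝ) < r := NNReal.coe_pos.2 (pos_iff_ne_zero.2 hr0)
    rw [norm_mul, Complex.norm_real, Real.norm_of_nonneg this.le]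
    nlinarith
  · rw [hder.deriv, smul_smul, inv_mul_cancel₀ hr0', one_smul]
  · rw [← ENNReal.coe_inv hr0, enorm_eq_nnnorm, nnnorm_inv]
    simp

theorem norm_deriv_le_one_of_mapsTo_disc {g : ℂ → ℂ} (hg : DifferentiableOn ℂ g disc)
    (hgD : MapsTo g disc disc) : ‖deriv g 0‖ ≤ 1 := by
  by_contra! h
  set d := ‖deriv g 0‖
  -- Midpoint of `d⁻¹` and 1: Cauchy's estimate on this circle gives `d ρ ≤ 1`, whereas `d ρ = (d +
  -- 1) / 2 > 1`.
  set ρ : ℝ := (1 + d⁻¹) / 2 with hρ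
  have hd : 0 < d := by linarith
  have hd1 : d⁻¹ < 1 := inv_lt_one_of_one_lt₀ h
  have hρ0 : 0 < ρ := by positivity
  have hsub : closedBall (0 : ℂ) ρ ⊆ disc := closedBall_subset_ball (by linarith)
  have h1 : d ≤ 1 / ρ := Complex.norm_deriv_le_of_forall_mem_sphere_norm_le hρ0
    (hg.diffContOnCl_ball hsub) fun ζ hζ => by
      have := hgD (hsub (sphere_subset_closedBall hζ))
      rw [disc, mem_ball_zero_iff] at this
      exact this.le
  rw [le_div_iff₀ hρ0, hρ] at h1
  have h2 : d * ((1 + d⁻¹) / 2) = (d + 1) / 2 := by field_simp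
  linarith

theorem caratheodoryMetric_le_kobayashiMetric (hD : IsOpen D) (X : Cn n) :
    caratheodoryMetric D z X ≤ kobayashiMetric D z X := by
  refine iSup₂_le fun f hf => le_iInf fun α => le_iInf₂ fun φ hφ => ?_
  obtain ⟨hfd, hfD⟩ := hf
  obtain ⟨hφd, hφD, hφ0, hα⟩ := hφ
  have h0 : (0 : ℂ) ∈ disc := mem_ball_self one_pos
  have hzD : φ 0 ∈ D := hφD h0
  have h1 : HasDerivAt φ (deriv φ 0) 0 :=
    ((hφd 0 h0).differentiableAt (isOpen_ball.mem_nhds h0)).hasDerivAt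
  have h2 : HasFDerivAt f (fderiv ℂ f (φ 0)) (φ 0) :=
    ((hfd _ hzD).differentiableAt (hD.mem_nhds hzD)).hasFDerivAt
  have h3 := (h2.comp_hasDerivAt 0 h1).deriv
  have h4 : ‖deriv (f ∘ φ) 0‖ ≤ 1 :=
    norm_deriv_le_one_of_mapsTo_disc (hfd.comp hφd hφD) (hfD.comp hφD)
  rw [← hα, map_smul, ← hφ0, ← h3, enorm_smul]
  calc ‖α‖ₑ * ‖deriv (f ∘ φ) 0‖ₑ ≤ ‖α‖ₑ * 1 := by
        gcongr
        rw [enorm_eq_nnnorm]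
        exact_mod_cast h4
    _ = ‖α‖ₑ := mul_one _

theorem enorm_apply_le_caratheodoryMetric (hD : IsCConvexDomainWithoutLines D) (hz : z ∈ D)
    {f : Cn n →L[ℂ] ℂ} (hf : OmitsOne D z f) (X : Cn n) :
    ‖f X‖ₑ ≤ 32 * caratheodoryMetric D z X := by
  obtain ⟨g, hg, -, hg7, hgX⟩ := exists_bounded_function hD hz hf
  -- Division by 8 takes the bound 7 strictly below 1. The final constant is `4 * 8`.
  have h1 : ‖fderiv ℂ (fun w => (8 : ℂ)⁻¹ * g w) z X‖ₑ ≤ caratheodoryMetric D z X := by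
    refine le_iSup₂_of_le (fun w => (8 : ℂ)⁻¹ * g w) ⟨hg.const_mul _, fun w hw => ?_⟩ le_rfl
    rw [disc, mem_ball_zero_iff, norm_mul]
    have := hg7 w hw
    norm_num
    linarith
  refine le_trans ?_ (mul_le_mul_right h1 32)
  rw [fderiv_const_mul ((hg z hz).differentiableAt (hD.isOpen.mem_nhds hz))]
  have h2 := hgX X
  have h3 : ‖f X‖ ≤ 32 * ‖((8 : ℂ)⁻¹ • fderiv ℂ g z) X‖ := by
    rw [smul_apply, norm_smul]
    norm_num
    linarith
  rw [← ofReal_norm, ← ofReal_norm, ← ENNReal.ofReal_ofNat 32,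
    ← ENNReal.ofReal_mul (by norm_num)]
  exact ENNReal.ofReal_le_ofReal h3

end Metrics
-- The mean value inequality
section MeanValue

variable {n : ℕ}

theorem enorm_sq_le_lintegral_circle {F : Cn n → ℂ} {y w : Cn n} {s : ℝ}
    (hF : DifferentiableOn ℂ F (ball y s)) (hw : ‖w‖ < s) :
    ‖F y‖ₑ ^ 2 * ENNReal.ofReal (2 * Real.pi) ≤
      ∫⁻ θ in Ioc 0 (2 * Real.pi), ‖F (y + circleMap 0 1 θ • w)‖ₑ ^ 2 := by
  set U : Set ℂ := (fun ζ : ℂ => y + ζ • w) ⁻¹' ball y s with hU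
  have hsub : closedBall (0 : ℂ) 1 ⊆ U := by
    intro ζ hζ
    rw [mem_closedBall_zero_iff] at hζ
    rw [hU, mem_preimage, mem_ball, dist_eq_norm, add_sub_cancel_left, norm_smul]
    nlinarith [norm_nonneg w]
  have hd : DifferentiableOn ℂ (fun ζ : ℂ => F (y + ζ • w) ^ 2) U :=
    (hF.comp (t := ball y s) (f := fun ζ : ℂ => y + ζ • w) (by fun_prop) fun ζ hζ => hζ).pow 2
  have h1 := DiffContOnCl.circleAverage (c := 0) (R := 1)
    (by rw [abs_one]; exact hd.diffContOnCl_ball hsub)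
  rw [Real.circleAverage_def, intervalIntegral.integral_of_le (by positivity)] at h1
  simp only [zero_smul, add_zero] at h1
  have h2 : ∫ θ in Ioc 0 (2 * Real.pi), F (y + circleMap 0 1 θ • w) ^ 2 =
      (2 * Real.pi) • F y ^ 2 := by
    rw [← h1, smul_smul, mul_inv_cancel₀ (by positivity), one_smul]
  have h3 := enorm_integral_le_lintegral_enorm (μ := volume.restrict (Ioc 0 (2 * Real.pi)))
    fun θ : ℝ => F (y + circleMap 0 1 θ • w) ^ 2
  rw [h2, enorm_smul, Real.enorm_of_nonneg (by positivity), enorm_pow, mul_comm] at h3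
  simpa only [enorm_pow] using h3

/-- Multiplication by a unimodular number followed by a translation preserves the volume. -/
theorem setLIntegral_ball_rotate (H : Cn n → ℝ≥0∞) (y : Cn n) (s : ℝ) {u : ℂ} (hu : ‖u‖ = 1) :
    ∫⁻ w in ball (0 : Cn n) s, H (y + u • w) = ∫⁻ x in ball y s, H x := by
  have hu0 : u ≠ 0 := norm_pos_iff.1 (by rw [hu]; exact one_pos)
  let e : Cn n ≃ₗᵢ[ℝ] Cn n :=
    { toLinearEquiv := (LinearEquiv.smulOfNeZero ℂ (Cn n) u hu0).restrictScalars ℝ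
      norm_map' := fun x => by
        change ‖u • x‖ = ‖x‖
        rw [norm_smul, hu, one_mul] }
  have hmp : MeasurePreserving (fun w => y + e w) (volume : Measure (Cn n)) volume :=
    (measurePreserving_add_left volume y).comp e.measurePreserving
  have hemb : MeasurableEmbedding (fun w => y + e w) :=
    (e.toHomeomorph.trans (Homeomorph.addLeft y)).measurableEmbedding
  rw [← hmp.setLIntegral_comp_preimage_emb hemb H (ball y s)]
  congr 2
  ext w
  rw [mem_preimage, mem_ball_zero_iff, mem_ball, dist_eq_norm, add_sub_cancel_left, e.norm_map]

/-- The mean value inequality for `|F|²` on balls. -/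
theorem enorm_sq_mul_volume_ball_le {F : Cn n → ℂ} {y : Cn n} {s : ℝ}
    (hF : DifferentiableOn ℂ F (ball y s)) :
    ‖F y‖ₑ ^ 2 * volume (ball (0 : Cn n) s) ≤ ∫⁻ x in ball y s, ‖F x‖ₑ ^ 2 := by
  have hπ : ENNReal.ofReal (2 * Real.pi) ≠ 0 := by
    simp [Real.pi_pos]
  have hcont : ContinuousOn (fun p : Cn n × ℝ => ‖F (y + circleMap 0 1 p.2 • p.1)‖ₑ ^ 2)
      (ball 0 s ×ˢ univ) := by
    have h1 : ContinuousOn (fun p : Cn n × ℝ => F (y + circleMap 0 1 p.2 • p.1))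
        (ball 0 s ×ˢ univ) := by
      refine hF.continuousOn.comp (Continuous.continuousOn ?_) ?_
      · have := continuous_circleMap 0 1
        fun_prop
      · rintro ⟨w, θ⟩ ⟨hw, -⟩
        have hw' : ‖w‖ < s := by simpa using hw
        simpa [norm_smul] using hw'
    have h2 : Continuous fun a : ℂ => ‖a‖ₑ ^ 2 := (ENNReal.continuous_pow 2).comp continuous_enorm
    exact h2.comp_continuousOn h1
  have hmeas : AEMeasurable (Function.uncurry fun (w : Cn n) (θ : ℝ) =>
      ‖F (y + circleMap 0 1 θ • w)‖ₑ ^ 2)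
      ((volume.restrict (ball (0 : Cn n) s)).prod (volume.restrict (Ioc 0 (2 * Real.pi)))) := by
    rw [Measure.prod_restrict]
    exact (hcont.mono (prod_mono Subset.rfl (subset_univ _))).aemeasurable
      (measurableSet_ball.prod measurableSet_Ioc)
  -- Average the one-variable inequality over all `w` in the ball and exchange the integrals.
  -- Rotation invariance makes the inner integral independent of `θ`.
  have h1 : ‖F y‖ₑ ^ 2 * volume (ball (0 : Cn n) s) * ENNReal.ofReal (2 * Real.pi) ≤
      (∫⁻ x in ball y s, ‖F x‖ₑ ^ 2) * ENNReal.ofReal (2 * Real.pi) := by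
    calc ‖F y‖ₑ ^ 2 * volume (ball (0 : Cn n) s) * ENNReal.ofReal (2 * Real.pi)
        = ∫⁻ w in ball (0 : Cn n) s, ‖F y‖ₑ ^ 2 * ENNReal.ofReal (2 * Real.pi) := by
          rw [setLIntegral_const]; ring
      _ ≤ ∫⁻ w in ball (0 : Cn n) s, ∫⁻ θ in Ioc 0 (2 * Real.pi),
            ‖F (y + circleMap 0 1 θ • w)‖ₑ ^ 2 :=
          setLIntegral_mono' measurableSet_ball fun w hw =>
            enorm_sq_le_lintegral_circle hF (by simpa using hw)
      _ = ∫⁻ θ in Ioc 0 (2 * Real.pi), ∫⁻ w in ball (0 : Cn n) s,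
            ‖F (y + circleMap 0 1 θ • w)‖ₑ ^ 2 := lintegral_lintegral_swap hmeas
      _ = ∫⁻ θ in Ioc 0 (2 * Real.pi), ∫⁻ x in ball y s, ‖F x‖ₑ ^ 2 := by
          refine lintegral_congr fun θ => ?_
          exact setLIntegral_ball_rotate (fun x => ‖F x‖ₑ ^ 2) y s (by simp)
      _ = _ := by
          rw [setLIntegral_const, Real.volume_Ioc, sub_zero]
  exact (ENNReal.mul_le_mul_iff_left hπ ENNReal.ofReal_ne_top).1 h1

end MeanValue

/-! ### Coordinates scaled by the radii -/

section Coordinates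

variable {n : ℕ}

/-- The linear map `x ↦ ∑ j, r_j x_j b_j`. -/
noncomputable def scaledCoord (b : OrthonormalBasis (Fin n) ℂ (Cn n)) (r : Fin n → ℝ≥0) :
    Cn n →L[ℂ] Cn n :=
  ∑ j, ((r j : ℝ) : ℂ) • (EuclideanSpace.proj j : Cn n →L[ℂ] ℂ).smulRight (b j)

variable (b : OrthonormalBasis (Fin n) ℂ (Cn n)) (r : Fin n → ℝ≥0)

theorem inner_scaledCoord (x : Cn n) (j : Fin n) :
    inner ℂ (b j) (scaledCoord b r x) = ((r j : ℝ) : ℂ) * x j := by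
  simp only [scaledCoord, sum_apply, smul_apply,
    ContinuousLinearMap.smulRight_apply, inner_sum, inner_smul_right,
    orthonormal_iff_ite.1 b.orthonormal]
  simp

variable {r}

theorem injective_scaledCoord (hr : ∀ j, 0 < r j) : Function.Injective (scaledCoord b r) := by
  intro x y hxy
  ext j
  have h := congrArg (fun v => inner ℂ (b j) v) hxy
  simp only [inner_scaledCoord] at h
  exact mul_left_cancel₀ (by exact_mod_cast (hr j).ne') h

theorem basisSum_scaledCoord (hr : ∀ j, 0 < r j) (x : Cn n) :
    (basisSum b r (scaledCoord b r x) : ℝ) = ∑ j, ‖x j‖ := by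
  rw [coe_basisSum]
  refine Finset.sum_congr rfl fun j _ => ?_
  have : (0 : ℝ) < r j := hr j
  rw [inner_scaledCoord, norm_mul, Complex.norm_real, Real.norm_of_nonneg this.le]
  field_simp

theorem norm_le_sum_norm_apply (x : Cn n) : ‖x‖ ≤ ∑ j, ‖x j‖ := by
  calc ‖x‖ = ‖∑ j, (EuclideanSpace.basisFun (Fin n) ℂ).repr x j •
          EuclideanSpace.basisFun (Fin n) ℂ j‖ := by rw [OrthonormalBasis.sum_repr]
    _ ≤ ∑ j, ‖x j‖ := (norm_sum_le _ _).trans_eq (by simp [norm_smul])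

theorem exists_scaledCoord_eq (hr : ∀ j, 0 < r j) (X : Cn n) :
    ∃ x : Cn n, scaledCoord b r x = X ∧ ‖x‖ ≤ basisSum b r X := by
  obtain ⟨x, hx⟩ := (LinearMap.injective_iff_surjective (f := (scaledCoord b r : Cn n →ₗ[ℂ] Cn n))).1
    (injective_scaledCoord b hr) X
  have hx' : scaledCoord b r x = X := hx
  refine ⟨x, hx', ?_⟩
  rw [← hx', basisSum_scaledCoord b hr]
  exact norm_le_sum_norm_apply x

/-- The real Jacobian is the squared modulus of the complex determinant. An orthonormal basis has
determinant of modulus 1, leaving the product of the scalings. -/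
theorem abs_det_scaledCoord :
    |((scaledCoord b r).restrictScalars ℝ).det| = ((∏ j, r j) ^ 2 : ℝ≥0) := by
  set e := EuclideanSpace.basisFun (Fin n) ℂ
  have h1 := e.toBasis.det_comp (scaledCoord b r : Cn n →ₗ[ℂ] Cn n) e.toBasis
  rw [Module.Basis.det_self, mul_one] at h1
  have h2 : ((scaledCoord b r : Cn n →ₗ[ℂ] Cn n) ∘ e.toBasis) =
      fun j => ((r j : ℝ) : ℂ) • b j := by
    ext j : 1
    simp [scaledCoord, e]
  rw [h2] at h1
  have h3 := MultilinearMap.map_smul_univ (e.toBasis.det.toMultilinearMap)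
    (fun j => ((r j : ℝ) : ℂ)) b
  have h4 : ‖LinearMap.det (scaledCoord b r : Cn n →ₗ[ℂ] Cn n)‖ = ∏ j, (r j : ℝ) := by
    rw [← h1]
    refine (congrArg norm h3).trans ?_
    rw [norm_smul, norm_prod]
    have := e.det_to_matrix_orthonormalBasis b
    change _ * ‖e.toBasis.det b‖ = _
    rw [this, mul_one]
    simp
  have h5 : ((scaledCoord b r).restrictScalars ℝ).det =
      Complex.normSq (LinearMap.det (scaledCoord b r : Cn n →ₗ[ℂ] Cn n)) := by
    rw [← Algebra.norm_complex_apply, ← LinearMap.det_restrictScalars]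
    rfl
  rw [h5, Complex.normSq_eq_norm_sq, h4, abs_of_nonneg (by positivity)]
  push_cast
  rfl

theorem setLIntegral_image_scaledCoord (hr : ∀ j, 0 < r j) (z : Cn n) {s : Set (Cn n)}
    (hs : MeasurableSet s) (g : Cn n → ℝ≥0∞) :
    ∫⁻ w in (fun x => z + scaledCoord b r x) '' s, g w =
      ((∏ j, r j) ^ 2 : ℝ≥0) * ∫⁻ x in s, g (z + scaledCoord b r x) := by
  rw [lintegral_image_eq_lintegral_abs_det_fderiv_mul (f' := fun _ =>
    (scaledCoord b r).restrictScalars ℝ) volume hs]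
  · rw [abs_det_scaledCoord, ENNReal.ofReal_coe_nnreal]
    rw [lintegral_const_mul' _ _ ENNReal.coe_ne_top]
  · intro x _
    exact (((scaledCoord b r).restrictScalars ℝ).hasFDerivAt.const_add z).hasFDerivWithinAt
  · intro x _ y _ hxy
    exact injective_scaledCoord b hr (add_left_cancel hxy)

end Coordinates
-- Adapted bases and the peak function
section Bergman

variable {n : ℕ} {D : Set (Cn n)} {z : Cn n}
  {b : OrthonormalBasis (Fin n) ℂ (Cn n)} {r : Fin n → ℝ≥0}

/-- The norm `basisSum b r` is comparable to the support function of the hyperplanes missing `D`,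
that is, to the reciprocal of the boundary distance. -/
structure IsAdapted (D : Set (Cn n)) (z : Cn n) (b : OrthonormalBasis (Fin n) ℂ (Cn n))
    (r : Fin n → ℝ≥0) : Prop where
  pos : ∀ k, 0 < r k
  apply_le : ∀ f, OmitsOne D z f → ∀ k, ‖f (b k)‖ ≤ (r k : ℝ)⁻¹
  sum_le : ∀ X t, (∀ f, OmitsOne D z f → ‖f X‖ ≤ t) → (basisSum b r X : ℝ) ≤ 2 ^ n * t

theorem IsMaximalBasis.isAdapted (h : IsMaximalBasis D z b r) (hD : IsCConvexDomainWithoutLines D)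
    (hz : z ∈ D) : IsAdapted D z b r :=
  have hpos : ∀ k, 0 < r k := fun k => pos_of_notMem hz (h.notMem hD.isOpen k)
  ⟨hpos, fun f hf k => hf.norm_apply_le (hpos k) fun ζ => h.disc_subset hz k, fun X t ht =>
    basisSum_le_of_norm_inner_div_le ((norm_nonneg _).trans (ht 0 fun w _ => by simp))
      (h.norm_inner_div_le hD hz ht)⟩

theorem IsMinimalBasis.isAdapted (h : IsMinimalBasis D z b r) (hD : IsCConvexDomainWithoutLines D)
    (hz : z ∈ D) : IsAdapted D z b r :=
  have hpos : ∀ k, 0 < r k := fun k => pos_of_notMem hz (h.notMem hD.isOpen k)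
  ⟨hpos, fun f hf k => hf.norm_apply_le (hpos k) fun ζ => h.disc_subset hz k, fun X t ht =>
    basisSum_le_of_norm_inner_div_le ((norm_nonneg _).trans (ht 0 fun w _ => by simp))
      (h.norm_inner_div_le hD hz ht)⟩

theorem IsAdapted.enorm_apply_le (h : IsAdapted D z b r) {f : Cn n →L[ℂ] ℂ}
    (hf : OmitsOne D z f) (X : Cn n) : ‖f X‖ₑ ≤ basisSum b r X := by
  have := norm_apply_le_basisSum (h.apply_le f hf) X
  rw [enorm_eq_nnnorm]
  exact_mod_cast this

theorem IsAdapted.coe_basisSum_le (h : IsAdapted D z b r) {X : Cn n} {a : ℝ≥0∞}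
    (ha : ∀ f, OmitsOne D z f → ‖f X‖ₑ ≤ a) : (basisSum b r X : ℝ≥0∞) ≤ 2 ^ n * a := by
  rcases eq_or_ne a ⊤ with rfl | hne
  · rw [ENNReal.mul_top (by positivity)]
    exact le_top
  lift a to ℝ≥0 using hne
  have := h.sum_le X a fun f hf => by
    have := ha f hf
    rw [enorm_eq_nnnorm] at this
    exact_mod_cast this
  exact_mod_cast this

/-- A functional equal to 1 at an excluded point would have modulus at most `∑ |x_j| ≤ n ‖x‖ < 1`
there. -/
theorem IsAdapted.mem (h : IsAdapted D z b r) (hD : IsCConvexDomainWithoutLines D) (hz : z ∈ D)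
    {x : Cn n} (hx : ‖x‖ < ((n : ℝ) + 1)⁻¹) : z + scaledCoord b r x ∈ D := by
  by_contra hc
  obtain ⟨f, hf, hf1⟩ := hD.exists_functional hz hc
  have h1 := norm_apply_le_basisSum (h.apply_le f hf) (scaledCoord b r x)
  rw [hf1, norm_one, basisSum_scaledCoord b h.pos] at h1
  have h2 : ∑ j, ‖x j‖ ≤ n * ‖x‖ := by
    refine (Finset.sum_le_card_nsmul _ _ ‖x‖ fun j _ => PiLp.norm_apply_le x j).trans_eq ?_
    simp
  have h3 : ((n : ℝ) + 1) * ‖x‖ < 1 := by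
    rwa [← lt_inv_mul_iff₀ (by positivity), mul_one]
  nlinarith [norm_nonneg x]

/-- The constant in the mean value inequality on the balls of radius `1 / (2 (n + 1))`. -/
noncomputable def meanConst (n : ℕ) : ℝ≥0 :=
  NNReal.sqrt ((volume (ball (0 : Cn n) (((n : ℝ) + 1)⁻¹ / 2))).toNNReal)⁻¹

/-- The mean value inequality is applied in scaled coordinates on the ball of radius `ρ / 2` about
`y`, whose image lies in `D`. The Jacobian contributes the product of the radii. -/
theorem IsAdapted.norm_le (h : IsAdapted D z b r) (hD : IsCConvexDomainWithoutLines D)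
    (hz : z ∈ D) {f : Cn n → ℂ} (hf : InBergmanUnitBall D f) {y : Cn n}
    (hy : ‖y‖ < ((n : ℝ) + 1)⁻¹ / 2) :
    (∏ j, r j) * ‖f (z + scaledCoord b r y)‖₊ ≤ meanConst n := by
  set ρ : ℝ := ((n : ℝ) + 1)⁻¹
  have hρ : 0 < ρ := by positivity
  set F : Cn n → ℂ := fun x => f (z + scaledCoord b r x) with hFdef
  have hsub : ball y (ρ / 2) ⊆ ball 0 ρ := by
    refine ball_subset_ball' ?_
    rw [dist_zero_right]
    linarith
  have hmaps : MapsTo (fun x => z + scaledCoord b r x) (ball y (ρ / 2)) D := fun x hx =>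
    h.mem hD hz (by simpa using hsub hx)
  have hF : DifferentiableOn ℂ F (ball y (ρ / 2)) :=
    hf.1.comp (f := fun x => z + scaledCoord b r x) (by fun_prop) hmaps
  have h1 := enorm_sq_mul_volume_ball_le hF
  have h2 := setLIntegral_image_scaledCoord b h.pos z (measurableSet_ball (x := y) (ε := ρ / 2))
    fun w => ‖f w‖ₑ ^ 2
  have h3 : ((∏ j, r j) ^ 2 : ℝ≥0) * (‖F y‖ₑ ^ 2 * volume (ball (0 : Cn n) (ρ / 2))) ≤ 1 := by
    calc ((∏ j, r j) ^ 2 : ℝ≥0) * (‖F y‖ₑ ^ 2 * volume (ball (0 : Cn n) (ρ / 2)))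
        ≤ ((∏ j, r j) ^ 2 : ℝ≥0) * ∫⁻ x in ball y (ρ / 2), ‖F x‖ₑ ^ 2 := by gcongr
      _ = ∫⁻ w in (fun x => z + scaledCoord b r x) '' ball y (ρ / 2), ‖f w‖ₑ ^ 2 := h2.symm
      _ ≤ ∫⁻ w in D, ‖f w‖ₑ ^ 2 := lintegral_mono_set hmaps.image_subset
      _ ≤ 1 := hf.2
  set v := volume (ball (0 : Cn n) (ρ / 2)) with hv
  have hvtop : v ≠ ⊤ := measure_ball_lt_top.ne
  have hv0 : v ≠ 0 := (measure_ball_pos _ _ (by positivity)).ne'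
  have hvN : 0 < v.toNNReal := ENNReal.toNNReal_pos hv0 hvtop
  rw [← ENNReal.coe_toNNReal hvtop, enorm_eq_nnnorm] at h3
  have h4 : (∏ j, r j) ^ 2 * (‖F y‖₊ ^ 2 * v.toNNReal) ≤ 1 := by exact_mod_cast h3
  rw [meanConst, NNReal.le_sqrt_iff_sq_le, NNReal.le_inv_iff_mul_le hvN.ne', mul_pow, mul_assoc]
  exact h4

theorem IsAdapted.norm_fderiv_le (h : IsAdapted D z b r) (hD : IsCConvexDomainWithoutLines D)
    (hz : z ∈ D) {f : Cn n → ℂ} (hf : InBergmanUnitBall D f) (X : Cn n) :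
    (∏ j, r j) * ‖fderiv ℂ f z X‖₊ ≤ (4 * (n + 1) * meanConst n) * basisSum b r X := by
  set ρ : ℝ := ((n : ℝ) + 1)⁻¹ with hρdef
  have hρ : 0 < ρ := by positivity
  set F : Cn n → ℂ := fun x => f (z + scaledCoord b r x) with hFdef
  set P : ℝ := ((∏ j, r j : ℝ≥0) : ℝ) with hP
  have hP0 : 0 < P := NNReal.coe_pos.2 (Finset.prod_pos fun j _ => h.pos j)
  have hmaps : MapsTo (fun x => z + scaledCoord b r x) (ball 0 (ρ / 2)) D := fun x hx =>
    h.mem hD hz (by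
      have : ‖x‖ < ρ / 2 := by simpa using hx
      linarith)
  have hF : DifferentiableOn ℂ F (ball 0 (ρ / 2)) :=
    hf.1.comp (f := fun x => z + scaledCoord b r x) (by fun_prop) hmaps
  have hbd : ∀ y : Cn n, ‖y‖ < ρ / 2 → ‖F y‖ ≤ meanConst n / P := by
    intro y hy
    rw [le_div_iff₀' hP0]
    exact_mod_cast h.norm_le hD hz hf hy
  -- The Schwarz-type estimate concerns the distance to `F 0`, hence the factor 2. With radius `ρ /
  -- 2` it produces the constant `4 (n + 1)`.
  have h1 : ‖fderiv ℂ F 0‖ ≤ (2 * (meanConst n / P)) / (ρ / 2) := by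
    refine Complex.norm_fderiv_le_div_of_mapsTo_ball hF (fun y hy => ?_) (by positivity)
    rw [mem_closedBall, dist_eq_norm]
    refine (norm_sub_le _ _).trans ?_
    have h2 := hbd y (by simpa using hy)
    have h3 := hbd 0 (by simpa using hρ)
    linarith
  obtain ⟨x, hx, hxn⟩ := exists_scaledCoord_eq b h.pos X
  have h2 : fderiv ℂ F 0 x = fderiv ℂ f z X := by
    have hd : HasFDerivAt f (fderiv ℂ f z) (z + scaledCoord b r 0) := by
      rw [map_zero, add_zero]
      exact ((hf.1 z hz).differentiableAt (hD.isOpen.mem_nhds hz)).hasFDerivAt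
    have h3 : HasFDerivAt (fun x => z + scaledCoord b r x) (scaledCoord b r) 0 :=
      (scaledCoord b r).hasFDerivAt.const_add z
    have h4 : HasFDerivAt F _ 0 := hd.comp 0 h3
    rw [h4.fderiv, ContinuousLinearMap.comp_apply, hx]
  have h3 : ‖fderiv ℂ f z X‖ ≤ (2 * (meanConst n / P)) / (ρ / 2) * basisSum b r X := by
    rw [← h2]
    refine (ContinuousLinearMap.le_opNorm _ _).trans ?_
    gcongr
  rw [← NNReal.coe_le_coe]
  push_cast
  rw [← NNReal.coe_prod, ← hP]
  calc P * ‖fderiv ℂ f z X‖ ≤ P * ((2 * (meanConst n / P)) / (ρ / 2) * basisSum b r X) := by gcongr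
    _ = _ := by
      rw [hρdef]
      field_simp
      ring

/-- A holomorphic function on `D` with value `1` at `z` which decays along `f`. -/
theorem exists_decaying_function (hD : IsCConvexDomainWithoutLines D) (hz : z ∈ D)
    {f : Cn n →L[ℂ] ℂ} (hf : OmitsOne D z f) : ∃ φ : Cn n → ℂ, DifferentiableOn ℂ φ D ∧ φ z = 1 ∧
      ∀ w ∈ D, ‖φ w‖ ^ 2 * (1 + ‖f (w - z)‖) ≤ 136 := by
  obtain ⟨c, hc, h, hd, hz1, hsq, h3⟩ := exists_root hD hz hf
  have h0 : ∀ w ∈ D, 1 + h w ≠ 0 := fun w hw => norm_pos_iff.1 (by linarith [h3 w hw])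
  refine ⟨fun w => (2 : ℂ) * (1 + h w)⁻¹, (DifferentiableOn.inv (hd.const_add 1) h0).const_mul 2,
    by norm_num [hz1], fun w hw => ?_⟩
  -- With `|φ| = 2 / p` and `|f| ≤ 1 + (1 + p)²`, the quantity is at most `4 (2 + (1 + p)²) / p²`.
  -- This decreases in `p` and equals 136 at `p = 1 / 3`.
  set p := ‖1 + h w‖ with hp
  have hp3 : 1 / 3 ≤ p := h3 w hw
  have hhw : ‖h w‖ ≤ 1 + p := by
    have : h w = (1 + h w) - 1 := by ring
    rw [this]
    refine (norm_sub_le _ _).trans ?_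
    rw [norm_one]
    linarith
  have hfw : ‖f (w - z)‖ ≤ 1 + (1 + p) ^ 2 := by
    have h1 : c * f (w - z) = 1 - h w ^ 2 := by linear_combination hsq w hw
    have h2 : ‖c * f (w - z)‖ ≤ 1 + ‖h w‖ ^ 2 := by
      rw [h1]
      refine (norm_sub_le _ _).trans ?_
      rw [norm_one, norm_pow]
    rw [norm_mul] at h2
    have h4 : ‖h w‖ ^ 2 ≤ (1 + p) ^ 2 := by gcongr
    nlinarith [norm_nonneg (f (w - z))]
  rw [norm_mul, norm_inv, ← hp, mul_pow, inv_pow]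
  have hp0 : 0 < p := by linarith
  have h2 : ‖(2 : ℂ)‖ = 2 := by norm_num
  rw [h2, mul_right_comm, ← div_eq_mul_inv, div_le_iff₀ (by positivity)]
  nlinarith

/-- The basis sum of the image of a unit vector is at least 1, so the support function is at least
`2 ^ (-n)`. Half of this value is reached by an actual functional. -/
theorem IsAdapted.exists_le_norm_apply (h : IsAdapted D z b r) {x : Cn n} (hx : ‖x‖ = 1) :
    ∃ f, OmitsOne D z f ∧ (2 ^ (n + 1) : ℝ)⁻¹ ≤ ‖f (scaledCoord b r x)‖ := by
  by_contra! hc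
  have h1 := h.sum_le (scaledCoord b r x) _ fun f hf => (hc f hf).le
  rw [basisSum_scaledCoord b h.pos] at h1
  have h2 := norm_le_sum_norm_apply x
  have h3 : (2 : ℝ) ^ n * (2 ^ (n + 1))⁻¹ = 1 / 2 := by
    rw [pow_succ]; field_simp
  linarith

theorem prod_mul_le_pow_card {ι : Type*} [DecidableEq ι] {S : Finset ι} {a : ι → ℝ} {C u : ℝ}
    (ha : ∀ i ∈ S, 0 ≤ a i) (haC : ∀ i ∈ S, a i ≤ C) {i : ι} (hi : i ∈ S) (hu : 0 ≤ u)
    (hiu : a i * u ≤ C) : (∏ i ∈ S, a i) * u ≤ C ^ S.card := by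
  rw [← Finset.mul_prod_erase S a hi, mul_right_comm, ← Finset.card_erase_add_one hi, pow_succ']
  have h1 : ∏ j ∈ S.erase i, a j ≤ C ^ (S.erase i).card :=
    (Finset.prod_le_prod (fun j hj => ha j (Finset.mem_of_mem_erase hj))
      fun j hj => haC j (Finset.mem_of_mem_erase hj)).trans_eq (by simp)
  exact mul_le_mul hiu h1 (Finset.prod_nonneg fun j hj => ha j (Finset.mem_of_mem_erase hj))
    ((mul_nonneg (ha i hi) hu).trans hiu)

theorem differentiableOn_prod {ι : Type*} {S : Finset ι} {φ : ι → Cn n → ℂ}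
    (h : ∀ s ∈ S, DifferentiableOn ℂ (φ s) D) : DifferentiableOn ℂ (fun w => ∏ s ∈ S, φ s w) D := by
  classical
  induction S using Finset.induction_on with
  | empty => simp
  | insert s S hs ih =>
    simp only [Finset.prod_insert hs]
    exact (h s (Finset.mem_insert_self s S)).mul
      (ih fun t ht => h t (Finset.mem_insert_of_mem ht))

/-- A holomorphic function with value `1` at `z` and square integral at most a constant
multiple of the volume of the polydisc with radii `r`. -/
theorem exists_peak_function (n : ℕ) (hn : 1 ≤ n) : ∃ C : ℝ≥0, 0 < C ∧
    ∀ (D : Set (Cn n)) (z : Cn n) (b : OrthonormalBasis (Fin n) ℂ (Cn n)) (r : Fin n → ℝ≥0),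
      IsCConvexDomainWithoutLines D → z ∈ D → IsAdapted D z b r →
      ∃ p : Cn n → ℂ, DifferentiableOn ℂ p D ∧ p z = 1 ∧
        ∫⁻ w in D, ‖p w‖ₑ ^ 2 ≤ ((C * ∏ j, r j) ^ 2 : ℝ≥0) := by
  classical
  have : Nonempty (Fin n) := ⟨⟨0, hn⟩⟩
  have : Nontrivial (Cn n) := inferInstance
  -- `2 * κ` is the lower bound of `exists_le_norm_apply`. Moving from a unit vector to a net point
  -- within `ε` loses at most `n * ε ≤ κ`. The net is fixed before `D`, so its cardinality depends
  -- only on `n`.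
  set κ : ℝ := (2 ^ (n + 2) : ℝ)⁻¹ with hκ
  have hκ0 : 0 < κ := by positivity
  have hκ1 : κ ≤ 1 := inv_le_one_of_one_le₀ (one_le_pow₀ (by norm_num))
  set ε : ℝ := κ / (n + 1) with hε
  have hε0 : 0 < ε := by positivity
  obtain ⟨S', hS', hfin, hcover⟩ := (isCompact_sphere (0 : Cn n) 1).finite_cover_balls hε0
  set S := hfin.toFinset with hS
  -- One more than the real dimension, so that `(1 + ‖x‖) ^ (-M)` is integrable.
  set M := 2 * n + 1 with hM
  set K : ℝ := (136 ^ S.card * κ⁻¹) ^ M with hK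
  have hK0 : 0 < K := by positivity
  have hI : ∫⁻ x : Cn n, ENNReal.ofReal ((1 + ‖x‖) ^ (-(M : ℝ))) < ⊤ := by
    refine finite_integral_one_add_norm ?_
    rw [finrank_real_of_complex, finrank_euclideanSpace_fin, hM]
    exact_mod_cast Nat.lt_succ_self _
  set I := ∫⁻ x : Cn n, ENNReal.ofReal ((1 + ‖x‖) ^ (-(M : ℝ))) with hIdef
  set C : ℝ≥0 := NNReal.sqrt (K.toNNReal * I.toNNReal + 1) with hC
  refine ⟨C, NNReal.sqrt_pos.2 (by positivity), ?_⟩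
  intro D z b r hD hz h
  choose! f hf hfT using fun (x : Cn n) (hx : ‖x‖ = 1) => h.exists_le_norm_apply hx
  have hSunit : ∀ s ∈ S, ‖s‖ = 1 := fun s hs => by simpa using hS' (hfin.mem_toFinset.1 hs)
  choose! φ hφd hφz hφ using fun (x : Cn n) (hx : ‖x‖ = 1) =>
    exists_decaying_function hD hz (hf x hx)
  have hnet : ∀ x : Cn n, ∃ s ∈ S, κ * ‖x‖ ≤ ‖f s (scaledCoord b r x)‖ := by
    have hunit : ∀ x : Cn n, ‖x‖ = 1 → ∃ s ∈ S, κ ≤ ‖f s (scaledCoord b r x)‖ := by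
      intro x hx
      obtain ⟨s, hs, hxs⟩ := mem_iUnion₂.1 (hcover (mem_sphere_zero_iff_norm.2 hx))
      have hsS : s ∈ S := hfin.mem_toFinset.2 hs
      refine ⟨s, hsS, ?_⟩
      have hs1 := hSunit s hsS
      have h1 := norm_apply_le_basisSum (h.apply_le (f s) (hf s hs1)) (scaledCoord b r (s - x))
      rw [basisSum_scaledCoord b h.pos] at h1
      have h2 : ∑ j, ‖(s - x) j‖ ≤ n * ‖s - x‖ := by
        refine (Finset.sum_le_card_nsmul _ _ ‖s - x‖ fun j _ =>
          PiLp.norm_apply_le (s - x) j).trans_eq ?_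
        simp
      have h3 : ‖s - x‖ < ε := by
        rw [← dist_eq_norm, dist_comm]
        exact hxs
      have h4 : n * ‖s - x‖ ≤ κ := by
        have : (n + 1 : ℝ) * ε = κ := by rw [hε]; field_simp
        nlinarith [norm_nonneg (s - x), (Nat.cast_nonneg n : (0 : ℝ) ≤ n)]
      have h5 := hfT s hs1
      have h6 : (2 ^ (n + 1) : ℝ)⁻¹ = 2 * κ := by
        rw [hκ, pow_succ 2 (n + 1)]; field_simp
      have h7 : ‖f s (scaledCoord b r s)‖ ≤ ‖f s (scaledCoord b r (s - x))‖ +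
          ‖f s (scaledCoord b r x)‖ := by
        refine le_trans (le_of_eq ?_) (norm_add_le _ _)
        rw [map_sub, map_sub, sub_add_cancel]
      linarith
    intro x
    rcases eq_or_ne x 0 with rfl | hx
    · obtain ⟨y, hy⟩ := NormedSpace.sphere_nonempty (x := (0 : Cn n)).2 zero_le_one
      obtain ⟨s, hs, -⟩ := hunit y (by simpa using hy)
      exact ⟨s, hs, by simp⟩
    · have hx0 : 0 < ‖x‖ := norm_pos_iff.2 hx
      obtain ⟨s, hs, h1⟩ := hunit ((‖x‖⁻¹ : ℂ) • x) (by
        rw [norm_smul, norm_inv, Complex.norm_real, norm_norm, inv_mul_cancel₀ hx0.ne'])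
      refine ⟨s, hs, ?_⟩
      rw [map_smul, map_smul, norm_smul, norm_inv, Complex.norm_real, norm_norm,
        le_inv_mul_iff₀ hx0] at h1
      linarith
  refine ⟨fun w => ∏ s ∈ S, φ s w ^ M, ?_, ?_, ?_⟩
  · have h1 : ∀ s ∈ S, DifferentiableOn ℂ (fun w => φ s w ^ M) D := fun s hs =>
      (hφd s (hSunit s hs)).fun_pow M
    exact differentiableOn_prod h1
  · exact Finset.prod_eq_one fun s hs => by rw [hφz s (hSunit s hs), one_pow]
  · set Φ : Cn n → Cn n := fun x => z + scaledCoord b r x with hΦ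
    have hΦc : Continuous Φ := by fun_prop
    have himg : D = Φ '' (Φ ⁻¹' D) := by
      rw [image_preimage_eq]
      intro w
      obtain ⟨x, hx, -⟩ := exists_scaledCoord_eq b h.pos (w - z)
      exact ⟨x, by simp [hΦ, hx]⟩
    -- For each `x` one net functional is at least `κ ‖x‖`, so its factor supplies the decay while
    -- the remaining factors are only bounded.
    have hpt : ∀ x ∈ Φ ⁻¹' D, ‖∏ s ∈ S, φ s (Φ x) ^ M‖ₑ ^ 2 ≤
        ENNReal.ofReal K * ENNReal.ofReal ((1 + ‖x‖) ^ (-(M : ℝ))) := by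
      intro x hx
      obtain ⟨s, hs, hsx⟩ := hnet x
      have h1 : (∏ s ∈ S, ‖φ s (Φ x)‖ ^ 2) * (1 + ‖f s (scaledCoord b r x)‖) ≤ 136 ^ S.card := by
        refine prod_mul_le_pow_card (fun _ _ => by positivity) (fun i hi => ?_) hs (by positivity) ?_
        · have := hφ i (hSunit i hi) (Φ x) hx
          nlinarith [norm_nonneg (f i (Φ x - z)), sq_nonneg ‖φ i (Φ x)‖]
        · have := hφ s (hSunit s hs) (Φ x) hx
          simpa [hΦ] using this
      have h2 : (∏ s ∈ S, ‖φ s (Φ x)‖ ^ 2) ≤ 136 ^ S.card * κ⁻¹ * (1 + ‖x‖)⁻¹ := by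
        rw [← div_eq_mul_inv, ← div_eq_mul_inv, div_div, le_div_iff₀ (by positivity)]
        refine le_trans ?_ h1
        gcongr
        nlinarith [norm_nonneg x]
      rw [← ofReal_norm, ← ENNReal.ofReal_pow (norm_nonneg _), ← ENNReal.ofReal_mul hK0.le]
      refine ENNReal.ofReal_le_ofReal ?_
      rw [norm_prod, Real.rpow_neg (by positivity), Real.rpow_natCast, hK, ← inv_pow, ← mul_pow]
      calc (∏ s ∈ S, ‖φ s (Φ x) ^ M‖) ^ 2 = (∏ s ∈ S, ‖φ s (Φ x)‖ ^ 2) ^ M := by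
            simp_rw [norm_pow]
            rw [← Finset.prod_pow, ← Finset.prod_pow]
            refine Finset.prod_congr rfl fun s _ => ?_
            rw [← pow_mul, ← pow_mul, mul_comm]
        _ ≤ _ := by
            refine pow_le_pow_left₀ (Finset.prod_nonneg fun _ _ => by positivity) h2 M
    rw [himg, setLIntegral_image_scaledCoord b h.pos z
      (hD.isOpen.preimage hΦc).measurableSet]
    have hint : ∫⁻ x in Φ ⁻¹' D, ‖∏ s ∈ S, φ s (Φ x) ^ M‖ₑ ^ 2 ≤ (C ^ 2 : ℝ≥0) := by
      calc ∫⁻ x in Φ ⁻¹' D, ‖∏ s ∈ S, φ s (Φ x) ^ M‖ₑ ^ 2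
          ≤ ∫⁻ x in Φ ⁻¹' D, ENNReal.ofReal K * ENNReal.ofReal ((1 + ‖x‖) ^ (-(M : ℝ))) :=
            setLIntegral_mono' (hD.isOpen.preimage hΦc).measurableSet hpt
        _ ≤ ∫⁻ x, ENNReal.ofReal K * ENNReal.ofReal ((1 + ‖x‖) ^ (-(M : ℝ))) :=
            setLIntegral_le_lintegral _ _
        _ = ENNReal.ofReal K * I := lintegral_const_mul' _ _ ENNReal.ofReal_ne_top
        _ ≤ (C ^ 2 : ℝ≥0) := by
            rw [hC, NNReal.sq_sqrt, ← ENNReal.coe_toNNReal hI.ne, ENNReal.ofReal]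
            exact_mod_cast le_self_add
    calc _ ≤ (((∏ j, r j) ^ 2 : ℝ≥0) : ℝ≥0∞) * (C ^ 2 : ℝ≥0) := by gcongr
      _ = _ := by rw [← ENNReal.coe_mul, mul_pow, mul_comm]

end Bergman
-- The Bergman kernel and metric
section BergmanBounds

variable {n : ℕ} {D : Set (Cn n)} {z : Cn n}
  {b : OrthonormalBasis (Fin n) ℂ (Cn n)} {r : Fin n → ℝ≥0}

theorem inBergmanUnitBall_inv_mul {q : Cn n → ℂ} {R : ℝ≥0} (hR : 0 < R)
    (hq : DifferentiableOn ℂ q D) (hqR : ∫⁻ w in D, ‖q w‖ₑ ^ 2 ≤ (R ^ 2 : ℝ≥0)) :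
    InBergmanUnitBall D fun w => ((R : ℝ) : ℂ)⁻¹ * q w := by
  refine ⟨hq.const_mul _, ?_⟩
  have h1 : ‖((R : ℝ) : ℂ)⁻¹‖ₑ = ((R⁻¹ : ℝ≥0) : ℝ≥0∞) := by
    rw [enorm_eq_nnnorm, nnnorm_inv]
    simp
  simp_rw [enorm_mul, mul_pow, h1]
  rw [lintegral_const_mul' _ _ (by simp)]
  calc ((R⁻¹ : ℝ≥0) : ℝ≥0∞) ^ 2 * ∫⁻ w in D, ‖q w‖ₑ ^ 2
      ≤ ((R⁻¹ : ℝ≥0) : ℝ≥0∞) ^ 2 * (R ^ 2 : ℝ≥0) := by gcongr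
    _ = 1 := by
      rw [← ENNReal.coe_pow, ← ENNReal.coe_mul, ← mul_pow, inv_mul_cancel₀ hR.ne', one_pow,
        ENNReal.coe_one]

theorem sq_rpow_half (a : ℝ≥0∞) : (a ^ 2) ^ (1 / 2 : ℝ) = a := by
  rw [← ENNReal.rpow_natCast, ← ENNReal.rpow_mul]
  norm_num

theorem IsAdapted.bergmanKernel_le (h : IsAdapted D z b r) (hD : IsCConvexDomainWithoutLines D)
    (hz : z ∈ D) : bergmanKernel D z ≤ (((meanConst n * (∏ j, r j)⁻¹ : ℝ≥0)) : ℝ≥0∞) ^ 2 := by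
  refine iSup₂_le fun f hf => ?_
  have hP : 0 < ∏ j, r j := Finset.prod_pos fun j _ => h.pos j
  have h1 := h.norm_le hD hz hf (y := 0) (by rw [norm_zero]; positivity)
  rw [map_zero, add_zero, ← le_inv_mul_iff₀ hP] at h1
  rw [enorm_eq_nnnorm]
  gcongr
  rwa [mul_comm]

theorem le_bergmanKernel {q : Cn n → ℂ} {R : ℝ≥0} (hR : 0 < R) (hq : DifferentiableOn ℂ q D)
    (hqz : q z = 1) (hqR : ∫⁻ w in D, ‖q w‖ₑ ^ 2 ≤ (R ^ 2 : ℝ≥0)) :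
    ((R⁻¹ : ℝ≥0) : ℝ≥0∞) ^ 2 ≤ bergmanKernel D z := by
  refine le_iSup₂_of_le _ (inBergmanUnitBall_inv_mul hR hq hqR) ?_
  simp only [hqz, mul_one]
  rw [enorm_eq_nnnorm, nnnorm_inv]
  simp

/-- Comparison of the Bergman kernel and the Bergman metric with adapted bases. -/
theorem exists_bergman_bounds (n : ℕ) (hn : 1 ≤ n) : ∃ C : ℝ≥0,
    ∀ (D : Set (Cn n)) (z : Cn n) (b : OrthonormalBasis (Fin n) ℂ (Cn n)) (r : Fin n → ℝ≥0),
      IsCConvexDomainWithoutLines D → z ∈ D → IsAdapted D z b r →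
      (∀ X, Comparable C (bergmanMetric D z X) (basisSum b r X)) ∧
      Comparable C (bergmanKernel D z) ((((∏ j, r j) ^ 2 : ℝ≥0) : ℝ≥0∞)⁻¹) := by
  obtain ⟨c, hc, hpeak⟩ := exists_peak_function n hn
  set m := meanConst n
  -- One summand for each inequality: upper and lower bound for the metric, then upper and lower
  -- bound for the kernel.
  refine ⟨(4 * (n + 1) * m) * c + 2 ^ n * (28 * c * m) + m ^ 2 + c ^ 2, ?_⟩
  intro D z b r hD hz h
  obtain ⟨p, hp, hpz, hpi⟩ := hpeak D z b r hD hz h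
  set P := ∏ j, r j with hPdef
  have hP : 0 < P := Finset.prod_pos fun j _ => h.pos j
  have hcP : 0 < c * P := mul_pos hc hP
  have hKle := h.bergmanKernel_le hD hz
  have hKge := le_bergmanKernel hcP hp hpz hpi
  have hK2le : bergmanKernel D z ^ (1 / 2 : ℝ) ≤ ((m * P⁻¹ : ℝ≥0) : ℝ≥0∞) :=
    (ENNReal.rpow_le_rpow hKle (by norm_num)).trans_eq (sq_rpow_half _)
  have hK2ge : (((c * P)⁻¹ : ℝ≥0) : ℝ≥0∞) ≤ bergmanKernel D z ^ (1 / 2 : ℝ) :=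
    (sq_rpow_half _).symm.trans_le (ENNReal.rpow_le_rpow hKge (by norm_num))
  have hK0 : bergmanKernel D z ^ (1 / 2 : ℝ) ≠ 0 := by
    refine (lt_of_lt_of_le ?_ hK2ge).ne'
    exact_mod_cast inv_pos.2 hcP
  have hKtop : bergmanKernel D z ^ (1 / 2 : ℝ) ≠ ⊤ := (hK2le.trans_lt ENNReal.coe_lt_top).ne
  refine ⟨fun X => ⟨?_, ?_⟩, ?_, ?_⟩
  · have hS : (⨆ (f : Cn n → ℂ) (_ : InBergmanUnitBall D f ∧ f z = 0), ‖fderiv ℂ f z X‖ₑ) ≤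
        ((P⁻¹ * ((4 * (n + 1) * m) * basisSum b r X) : ℝ≥0) : ℝ≥0∞) := by
      refine iSup₂_le fun f hf => ?_
      have h1 := h.norm_fderiv_le hD hz hf.1 X
      rw [← le_inv_mul_iff₀ hP] at h1
      rw [enorm_eq_nnnorm]
      exact_mod_cast h1
    rw [bergmanMetric, ENNReal.div_le_iff hK0 hKtop]
    refine hS.trans ?_
    calc ((P⁻¹ * ((4 * (n + 1) * m) * basisSum b r X) : ℝ≥0) : ℝ≥0∞)
        = (((4 * (n + 1) * m) * c : ℝ≥0) : ℝ≥0∞) * basisSum b r X * (((c * P)⁻¹ : ℝ≥0) : ℝ≥0∞) := by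
          rw [← ENNReal.coe_mul, ← ENNReal.coe_mul]
          congr 1
          field_simp
      _ ≤ _ := by
          gcongr
          rw [add_assoc, add_assoc]
          exact le_self_add
  · have hB : ∀ f, OmitsOne D z f →
        ‖f X‖ₑ ≤ ((28 * c * m : ℝ≥0) : ℝ≥0∞) * bergmanMetric D z X := by
      intro f hf
      -- The competitor is the normalised product `p * g`. As `p z = 1` and `g z = 0`, its
      -- derivative at `z` is that of `g` up to normalisation, and `28 = 4 * 7` combines the two
      -- constants of `g`.
      obtain ⟨g, hg, hgz, hg7, hgX⟩ := exists_bounded_function hD hz hf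
      have hR : 0 < 7 * (c * P) := by positivity
      have hqi : ∫⁻ w in D, ‖p w * g w‖ₑ ^ 2 ≤ ((7 * (c * P)) ^ 2 : ℝ≥0) := by
        calc ∫⁻ w in D, ‖p w * g w‖ₑ ^ 2 ≤ ∫⁻ w in D, 7 ^ 2 * ‖p w‖ₑ ^ 2 := by
              refine setLIntegral_mono' hD.isOpen.measurableSet fun w hw => ?_
              rw [enorm_mul, mul_pow, mul_comm]
              gcongr
              rw [enorm_eq_nnnorm]
              exact_mod_cast hg7 w hw
          _ = 7 ^ 2 * ∫⁻ w in D, ‖p w‖ₑ ^ 2 := lintegral_const_mul' _ _ (by simp)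
          _ ≤ 7 ^ 2 * ((c * P) ^ 2 : ℝ≥0) := by gcongr
          _ = _ := by push_cast; ring
      have hq := inBergmanUnitBall_inv_mul hR (hp.mul hg) hqi
      have hder : fderiv ℂ (fun w => (((7 * (c * P) : ℝ≥0) : ℝ) : ℂ)⁻¹ * (p w * g w)) z X =
          (((7 * (c * P) : ℝ≥0) : ℝ) : ℂ)⁻¹ * fderiv ℂ g z X := by
        have h1 := ((hp z hz).differentiableAt (hD.isOpen.mem_nhds hz)).hasFDerivAt
        have h2 := ((hg z hz).differentiableAt (hD.isOpen.mem_nhds hz)).hasFDerivAt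
        have h3 : HasFDerivAt (fun w => (((7 * (c * P) : ℝ≥0) : ℝ) : ℂ)⁻¹ * (p w * g w)) _ z :=
          (h1.mul h2).const_mul _
        rw [h3.fderiv]
        simp [hpz, hgz]
      have hle : ‖fderiv ℂ (fun w => (((7 * (c * P) : ℝ≥0) : ℝ) : ℂ)⁻¹ * (p w * g w)) z X‖ₑ ≤
          ⨆ (f : Cn n → ℂ) (_ : InBergmanUnitBall D f ∧ f z = 0), ‖fderiv ℂ f z X‖ₑ :=
        le_iSup₂_of_le (fun w => (((7 * (c * P) : ℝ≥0) : ℝ) : ℂ)⁻¹ * (p w * g w))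
          ⟨hq, by simp [hgz]⟩ le_rfl
      have hS : (⨆ (f : Cn n → ℂ) (_ : InBergmanUnitBall D f ∧ f z = 0), ‖fderiv ℂ f z X‖ₑ) =
          bergmanMetric D z X * bergmanKernel D z ^ (1 / 2 : ℝ) :=
        (ENNReal.div_mul_cancel hK0 hKtop).symm
      rw [hS, hder, enorm_mul] at hle
      have hR1 : ‖(((7 * (c * P) : ℝ≥0) : ℝ) : ℂ)⁻¹‖ₑ = (((7 * (c * P))⁻¹ : ℝ≥0) : ℝ≥0∞) := by
        rw [enorm_eq_nnnorm, nnnorm_inv, Complex.nnnorm_real,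
          Real.nnnorm_of_nonneg (NNReal.coe_nonneg _)]
        rfl
      rw [hR1] at hle
      have hfX : ‖f X‖ₑ ≤ 4 * ‖fderiv ℂ g z X‖ₑ := by
        rw [enorm_eq_nnnorm, enorm_eq_nnnorm]
        exact_mod_cast hgX X
      calc ‖f X‖ₑ ≤ 4 * ‖fderiv ℂ g z X‖ₑ := hfX
        _ = ((28 * (c * P) : ℝ≥0) : ℝ≥0∞) *
            ((((7 * (c * P))⁻¹ : ℝ≥0) : ℝ≥0∞) * ‖fderiv ℂ g z X‖ₑ) := by
          rw [← mul_assoc, ← ENNReal.coe_mul]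
          congr 1
          have : 28 * (c * P) * (7 * (c * P))⁻¹ = (4 : ℝ≥0) := by
            field_simp
            norm_num
          rw [this]
          rfl
        _ ≤ ((28 * (c * P) : ℝ≥0) : ℝ≥0∞) *
            (bergmanMetric D z X * ((m * P⁻¹ : ℝ≥0) : ℝ≥0∞)) := by
          exact mul_le_mul_right (hle.trans (mul_le_mul_right hK2le _)) _
        _ = _ := by
          rw [mul_left_comm, ← ENNReal.coe_mul, mul_comm]
          congr 2
          field_simp
    refine (h.coe_basisSum_le hB).trans ?_
    rw [← mul_assoc]
    gcongr
    have h2 : ((2 : ℝ≥0∞) ^ n) = ((2 ^ n : ℝ≥0) : ℝ≥0∞) := by push_cast; rfl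
    rw [h2, ← ENNReal.coe_mul]
    refine ENNReal.coe_le_coe.2 ?_
    rw [add_assoc, add_assoc]
    exact le_add_left le_self_add
  · refine hKle.trans ?_
    rw [← ENNReal.coe_inv (by positivity), ← ENNReal.coe_pow, ← ENNReal.coe_mul]
    refine ENNReal.coe_le_coe.2 ?_
    rw [mul_pow, inv_pow]
    gcongr
    rw [add_right_comm]
    exact le_add_left le_rfl
  · rw [← ENNReal.coe_inv (by positivity)]
    calc (((P ^ 2)⁻¹ : ℝ≥0) : ℝ≥0∞) = ((c ^ 2 : ℝ≥0) : ℝ≥0∞) * (((c * P)⁻¹ : ℝ≥0) : ℝ≥0∞) ^ 2 := by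
          rw [← ENNReal.coe_pow, ← ENNReal.coe_mul]
          congr 1
          field_simp
      _ ≤ _ := by
          gcongr
          exact le_add_left le_rfl

end BergmanBounds

/-! ### Assembly of the comparisons -/

theorem Comparable.mono {C C' : ℝ≥0} {x y : ℝ≥0∞} (h : Comparable C x y) (hC : C ≤ C') :
    Comparable C' x y :=
  ⟨h.1.trans (by gcongr), h.2.trans (by gcongr)⟩

end ExtremalBasis

open ExtremalBasis in
theorem proposition2 (n : ℕ) (hn : 1 ≤ n) :
    ∃ C : ℝ≥0, ∀ D : Set (Cn n), IsCConvexDomainWithoutLines D → ∀ z ∈ D,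
      ∀ (a : OrthonormalBasis (Fin n) ℂ (Cn n)) (m : Fin n → ℝ≥0), IsMaximalBasis D z a m →
        (∀ (e : OrthonormalBasis (Fin n) ℂ (Cn n)) (s : Fin n → ℝ≥0), IsMinimalBasis D z e s →
          ∀ X : Cn n, Comparable C (basisSum a m X) (basisSum e s X)) ∧
        (∀ X : Cn n, Comparable C (dirDist D z X)⁻¹ (basisSum a m X)) ∧
        (∀ X : Cn n, Comparable C (caratheodoryMetric D z X) (basisSum a m X)) ∧
        (∀ X : Cn n, Comparable C (kobayashiMetric D z X) (basisSum a m X)) ∧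
        (∀ X : Cn n, Comparable C (bergmanMetric D z X) (basisSum a m X)) ∧
        Comparable C (bergmanKernel D z) ((((∏ j, m j) ^ 2 : ℝ≥0) : ℝ≥0∞)⁻¹) := by
  obtain ⟨C, hC⟩ := exists_bergman_bounds n hn
  refine ⟨C + 2 ^ n * 32, fun D hD z hz a m ha => ?_⟩
  have h := ha.isAdapted hD hz
  have h2 : ((2 ^ n : ℝ≥0) : ℝ≥0∞) = 2 ^ n := by push_cast; rfl
  have h32 : (1 : ℝ≥0) ≤ 2 ^ n * 32 :=
    one_le_mul (one_le_pow₀ (by norm_num)) (by norm_num)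
  have h1C : ∀ x : ℝ≥0∞, x ≤ ((C + 2 ^ n * 32 : ℝ≥0) : ℝ≥0∞) * x := fun x =>
    le_mul_of_one_le_left (zero_le) (by exact_mod_cast le_add_left h32)
  have h2C : ∀ x : ℝ≥0∞, 2 ^ n * x ≤ ((C + 2 ^ n * 32 : ℝ≥0) : ℝ≥0∞) * x := fun x => by
    rw [← h2]
    gcongr
    exact le_add_left (le_mul_of_one_le_right (zero_le) (by norm_num))
  have hdA : ∀ X, (dirDist D z X)⁻¹ ≤ (basisSum a m X : ℝ≥0∞) := fun X =>
    inv_dirDist_le hD hz fun f hf => h.enorm_apply_le hf X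
  have hkd : ∀ X, kobayashiMetric D z X ≤ (dirDist D z X)⁻¹ := kobayashiMetric_le_inv_dirDist
  have hck : ∀ X, caratheodoryMetric D z X ≤ kobayashiMetric D z X :=
    caratheodoryMetric_le_kobayashiMetric hD.isOpen
  -- This closes the cycle Carathéodory ≤ Kobayashi ≤ 1/d_D ≤ A ≤ constant · Carathéodory.
  have hAc : ∀ X, (basisSum a m X : ℝ≥0∞) ≤
      ((C + 2 ^ n * 32 : ℝ≥0) : ℝ≥0∞) * caratheodoryMetric D z X := fun X => by
    refine (h.coe_basisSum_le fun f hf => enorm_apply_le_caratheodoryMetric hD hz hf X).trans ?_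
    rw [← mul_assoc]
    gcongr
    push_cast
    exact le_add_left le_rfl
  refine ⟨fun e s he X => ⟨?_, ?_⟩, fun X => ⟨?_, ?_⟩, fun X => ⟨?_, hAc X⟩, fun X => ⟨?_, ?_⟩,
    fun X => ?_, ?_⟩
  · exact (h.coe_basisSum_le fun f hf => (he.isAdapted hD hz).enorm_apply_le hf X).trans (h2C _)
  · exact ((he.isAdapted hD hz).coe_basisSum_le fun f hf => h.enorm_apply_le hf X).trans (h2C _)
  · exact (hdA X).trans (h1C _)
  · exact (h.coe_basisSum_le fun f hf => hf.enorm_apply_le X).trans (h2C _)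
  · exact (hck X).trans <| (hkd X).trans <| (hdA X).trans (h1C _)
  · exact (hkd X).trans <| (hdA X).trans (h1C _)
  · exact (hAc X).trans (by gcongr; exact hck X)
  · exact ((hC D z a m hD hz h).1 X).mono le_self_add
  · exact (hC D z a m hD hz h).2.mono le_self_add
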